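/- Let $m,\omega>0$ and $\hbar=1$. On the Hilbert space of one oscillator with number states $|n\rangle$, $n\ge 0$, let $\hat a|n\rangle=\sqrt n\,|n-1\rangle$ and $\hat a^\dagger|n\rangle=\sqrt{n+1}\,|n+1\rangle$, and put $$\hat\chi=\frac{\hat a^\dagger+\hat a}{\sqrt{2m\omega}},\qquad \hat p=i\sqrt{\frac{m\omega}{2}}\,(\hat a^\dagger-\hat a).$$ For $\vartheta>0$, $\zeta\in\mathbb C$, $\theta\in\mathbb R$ let $$\hat S(\zeta)=e^{\frac12\zeta^*\hat a^2-\frac12\zeta\hat a^{\dagger2}},\qquad \hat R(\theta)=e^{-i\theta(\hat a^\dagger\hat a+\frac12)},\qquad \hat K_\vartheta=e^{-\vartheta(\hat a^\dagger\hat a+\frac12)},\qquad \mathcal Z_\vartheta=\operatorname{Tr}\hat K_\vartheta ,$$ where the exponential of a (possibly unbounded) operator $G$ defined on finite linear combinations of number states is the time-one operator of the strongly continuous semigroup whose generator extends $G$. Let $\hat\rho_\vartheta=\mathcal Z_\vartheta^{-1}\hat K_\vartheta$ and consider the squeezed thermal state $$\hat\rho=\hat S(\zeta)\hat R(\theta)\,\hat\rho_\vartheta\,\hat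 R^\dagger(\theta)\hat S^\dagger(\zeta).$$ (1) For all such $\vartheta,\zeta,\theta$ the three exponentials exist and are uniquely determined. The operators $\hat K_\vartheta$ and $\hat S\hat R\hat K_\vartheta\hat R^\dagger\hat S^\dagger$ are trace class, both with trace $\mathcal Z_\vartheta$. The operator $\hat\rho$ is positive with trace $1$, and $\langle\hat\chi\rangle=\langle\hat p\rangle=0$, where $\langle A\rangle=\operatorname{Tr}(\hat\rho A)$. The covariance matrix elements $b=\langle\hat\chi^2\rangle$, $a=\langle\hat p^2\rangle$, $c=\frac12\langle\{\hat\chi,\hat p\}\rangle$ exist and are real, with $b>0$, and they satisfy the Robertson–Schrödinger uncertainty relation in the strict form $ab-c^2>\frac14$. With $\varphi=\ln\coth\frac\vartheta2$ one has $e^{2\varphi}=4(ab-c^2)$ and $$\mathcal Z_\vartheta=\frac{\sqrt{e^{2\varphi}-1}}{2}=\Bigl(ab-c^2-\frac14\Bigr)^{1/2}=\frac12\operatorname{csch}\frac\vartheta2 ;$$ in particular $\mathcal Z_\vartheta$ is real. (2) The covariance matrix fixes $\vartheta$ and $\zeta$ uniquely: for all real $a,b,c$ with $b>0$ and $ab-c^2>\frac14$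 there are $\vartheta>0$ and $\zeta\in\mathbb C$ such that, for all $\vartheta'>0$, $\zeta'\in\mathbb C$, $\theta'\in\mathbb R$, the squeezed thermal state with parameters $(\vartheta',\zeta',\theta')$ has $\langle\hat p^2\rangle=a$, $\langle\hat\chi^2\rangle=b$, $\frac12\langle\{\hat\chi,\hat p\}\rangle=c$ if and only if $\vartheta'=\vartheta$ and $\zeta'=\zeta$. -/

import Mathlib

open scoped NNReal Topology
open Filter

noncomputable section

namespace Oscillator

/-- The Hilbert space of one oscillator in the number representation. -/
abbrev Fock : Type := lp (fun _ : ℕ => ℂ) 2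

/-- Finite linear combinations of number states: the common invariant domain on which the
unbounded operators of the theory are defined. -/
abbrev Fin0 : Type := ℕ →₀ ℂ

/-- The number state `|n⟩`. -/
def ket (n : ℕ) : Fock := lp.single 2 n 1

/-- The inclusion of the finite linear combinations of number states in the Hilbert space. -/
def incl : Fin0 →ₗ[ℂ] Fock := Finsupp.linearCombination ℂ ket

/-- The annihilation operator, `a |n⟩ = √n |n-1⟩` (so `a |0⟩ = 0`). -/
def ann : Module.End ℂ Fin0 :=
  Finsupp.linearCombination ℂ
    (fun n : ℕ => Finsupp.single (n - 1) ((Real.sqrt (n : ℝ) : ℝ) : ℂ))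

/-- The creation operator, `a† |n⟩ = √(n+1) |n+1⟩`. -/
def cre : Module.End ℂ Fin0 :=
  Finsupp.linearCombination ℂ
    (fun n : ℕ => Finsupp.single (n + 1) ((Real.sqrt ((n : ℝ) + 1) : ℝ) : ℂ))

/-- `a† a + 1/2`. -/
def numHalf : Module.End ℂ Fin0 := cre * ann + (1 / 2 : ℂ) • 1

/-- The position operator `χ = (a† + a) / √(2 m ω)`. -/
def pos (m ω : ℝ) : Module.End ℂ Fin0 :=
  ((1 / Real.sqrt (2 * m * ω) : ℝ) : ℂ) • (cre + ann)

/-- The momentum operator `p = i √(m ω / 2) (a† - a)`. -/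
def mom (m ω : ℝ) : Module.End ℂ Fin0 :=
  (Complex.I * ((Real.sqrt (m * ω / 2) : ℝ) : ℂ)) • (cre - ann)

/-- A strongly continuous one-parameter semigroup of bounded operators. -/
structure IsC0Semigroup (T : ℝ≥0 → (Fock →L[ℂ] Fock)) : Prop where
  zero : T 0 = 1
  add : ∀ s t, T (s + t) = T s * T t
  cont : ∀ ψ, Continuous fun t => T t ψ

/-- `IsExp G E`: the bounded operator `E` is the exponential `exp G`, that is, the time-one
operator of a strongly continuous semigroup `t ↦ exp (t G)` whose infinitesimal generator
extends `G`. -/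
def IsExp (G : Module.End ℂ Fin0) (E : Fock →L[ℂ] Fock) : Prop :=
  ∃ T : ℝ≥0 → (Fock →L[ℂ] Fock), IsC0Semigroup T ∧
    (∀ v : Fin0, Tendsto (fun t : ℝ≥0 => ((t : ℝ)⁻¹ : ℂ) • (T t (incl v) - incl v))
      (𝓝[>] 0) (𝓝 (incl (G v)))) ∧
    T 1 = E

open Classical in
/-- The exponential `exp G` (the value `0` is used if `G` has no exponential). -/
def opExp (G : Module.End ℂ Fin0) : Fock →L[ℂ] Fock :=
  if h : ∃ E, IsExp G E then h.choose else 0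

/-- The exponent `½ ζ* a² - ½ ζ a†²` of the squeeze operator. -/
def squeezeGen (ζ : ℂ) : Module.End ℂ Fin0 :=
  ((1 / 2 : ℂ) * (starRingEnd ℂ) ζ) • ann ^ 2 - ((1 / 2 : ℂ) * ζ) • cre ^ 2

/-- The exponent `-i θ (a† a + 1/2)` of the rotation operator. -/
def rotationGen (θ : ℝ) : Module.End ℂ Fin0 := (-(Complex.I * (θ : ℂ))) • numHalf

/-- The exponent `-ϑ (a† a + 1/2)` of the thermal-like state. -/
def thermalGen (ϑ : ℝ) : Module.End ℂ Fin0 := (-(ϑ : ℂ)) • numHalf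

/-- The squeeze operator `S(ζ)`. -/
def squeeze (ζ : ℂ) : Fock →L[ℂ] Fock := opExp (squeezeGen ζ)

/-- The rotation operator `R(θ)`. -/
def rotation (θ : ℝ) : Fock →L[ℂ] Fock := opExp (rotationGen θ)

/-- `exp [-ϑ (a† a + 1/2)]`. -/
def boltzmann (ϑ : ℝ) : Fock →L[ℂ] Fock := opExp (thermalGen ϑ)

/-- `T` is trace class with trace `τ`: the diagonal matrix elements of `T` in every orthonormal
basis are (absolutely) summable, with sum `τ`. -/
def HasTrace (T : Fock →L[ℂ] Fock) (τ : ℂ) : Prop :=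
  ∀ e : HilbertBasis ℕ ℂ Fock, HasSum (fun n => inner ℂ (e n) (T (e n))) τ

/-- The trace `∑ₙ ⟨n| T |n⟩`, meaningful for trace class `T`. -/
def opTrace (T : Fock →L[ℂ] Fock) : ℂ := ∑' n, inner ℂ (ket n) (T (ket n))

/-- The normalisation `Z_ϑ = Tr exp [-ϑ (a† a + 1/2)]`. -/
def partitionFn (ϑ : ℝ) : ℂ := opTrace (boltzmann ϑ)

/-- The thermal-like state `ρ_ϑ = Z_ϑ⁻¹ exp [-ϑ (a† a + 1/2)]`. -/
def thermalState (ϑ : ℝ) : Fock →L[ℂ] Fock := (partitionFn ϑ)⁻¹ • boltzmann ϑ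

/-- `S(ζ) R(θ) T R(θ)† S(ζ)†`. -/
def dress (ζ : ℂ) (θ : ℝ) (T : Fock →L[ℂ] Fock) : Fock →L[ℂ] Fock :=
  squeeze ζ * rotation θ * T * ContinuousLinearMap.adjoint (rotation θ) *
    ContinuousLinearMap.adjoint (squeeze ζ)

/-- The squeezed thermal state `ρ = S(ζ) R(θ) ρ_ϑ R(θ)† S(ζ)†`. -/
def squeezedThermal (ϑ : ℝ) (ζ : ℂ) (θ : ℝ) : Fock →L[ℂ] Fock := dress ζ θ (thermalState ϑ)

/-- `⟨A⟩ = Tr (ρ A) = μ`: the densely defined operator `ρ A` extends to a bounded operator which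
is trace class with trace `μ`. -/
def HasExpectation (ρ : Fock →L[ℂ] Fock) (A : Module.End ℂ Fin0) (μ : ℂ) : Prop :=
  ∃ T : Fock →L[ℂ] Fock, (∀ v : Fin0, T (incl v) = ρ (incl (A v))) ∧ HasTrace T μ

/-- The covariance matrix elements: `b = ⟨χ²⟩`, `a = ⟨p²⟩`, `c = ½ ⟨{χ, p}⟩`. -/
def HasCovariance (m ω : ℝ) (ρ : Fock →L[ℂ] Fock) (a b c : ℝ) : Prop :=
  HasExpectation ρ (pos m ω ^ 2) (b : ℂ) ∧
  HasExpectation ρ (mom m ω ^ 2) (a : ℂ) ∧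
  HasExpectation ρ ((1 / 2 : ℂ) • (pos m ω * mom m ω + mom m ω * pos m ω)) (c : ℂ)

/-- The parameter `φ` with `e^{2φ} = coth² (ϑ/2)`, for `ϑ > 0`. -/
def phi (ϑ : ℝ) : ℝ := Real.log (Real.cosh (ϑ / 2) / Real.sinh (ϑ / 2))

end Oscillator

end

/-! ### Number states and ladder operators on finite combinations -/

namespace Oscillator

/-! The generators are unbounded, so the analysis rests on one estimate: if `G` grows like a
quadratic polynomial in the ladder operators, then `‖G ^ n v‖ ≤ C * n! * R ^ n` for every finite
combination `v` of number states, and compressing `G` to the first `N` levels keeps the same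
constants. If `G` is also dissipative, the exponentials of its compressions are contractions that
converge by the power series at small times, and their strong limits form a contraction semigroup
(`QuadGrowth.exists_semigroup`), unitary when `G` is antisymmetric. The same estimate gives
uniqueness. A sequence with `φ n' = φ (n + 1)`, `φ n 0 = 0` and a bound of this type vanishes
(`eq_zero_of_iterated_deriv`); this applies to the difference of two semigroups whose generators
extend `G`.

Number states are eigenvectors of the rotation and thermal generators. Hence the rotation cancels
from the state, and the thermal operator is diagonal with geometric weights. With `ν = ½ coth
(ϑ/2)`, the mean of `a† a` is `ν - 1/2` and `Z² = ν² - 1/4`.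

For squeezing, the vanishing lemma yields a weak Heisenberg picture (`inner_semigroup_heisenberg`),
which needs no invariant domain for `S`: the observable is moved across the inner product. Since
`[G, a] = ζ a†` and `[G, a†] = ζ* a`, the evolved ladder operators have hyperbolic coefficients.
Then `ρ A` is an absolutely convergent sum of rank-one operators, whose trace is the same in every
basis (`hasTrace_nuclear`).

For `ζ = r (p + i q)` with `p² + q² = 1` and `X = m ω` this gives `a = X ν (cosh 2r + p sinh 2r)`,
`b = (ν / X) (cosh 2r - p sinh 2r)`, `c = -ν q sinh 2r`. Hence `a b - c² = ν²`, from which the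
formulas for `Z` follow. Conversely the determinant gives `ν`, hence `ϑ`; the remaining data give
`sinh 2r` times `(p, q)`, and injectivity of `sinh` gives `ζ`. -/

theorem ket_apply (n k : ℕ) : (ket n : ℕ → ℂ) k = if k = n then 1 else 0 := by
  simp [ket, lp.single_apply, Pi.single_apply]

theorem incl_single (n : ℕ) (z : ℂ) : incl (Finsupp.single n z) = z • ket n := by
  simp [incl]

theorem incl_single_one (n : ℕ) : incl (Finsupp.single n 1) = ket n := by
  simp [incl]

theorem incl_apply (v : Fin0) (k : ℕ) : (incl v : ℕ → ℂ) k = v k := by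
  induction v using Finsupp.induction_linear with
  | zero => simp
  | add f g hf hg => simp [hf, hg]
  | single n z =>
    rw [incl_single, lp.coeFn_smul, Pi.smul_apply, ket_apply, Finsupp.single_apply]
    by_cases h : k = n
    · simp [h]
    · simp [h, Ne.symm h]

theorem inner_ket (n : ℕ) (x : Fock) : inner ℂ (ket n) x = (x : ℕ → ℂ) n := by
  simp [ket, lp.inner_single_left]

theorem norm_ket (n : ℕ) : ‖ket n‖ = 1 := by
  simp [ket, lp.norm_single]

theorem inner_ket_ket (n k : ℕ) : inner ℂ (ket n) (ket k) = if n = k then (1 : ℂ) else 0 := by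
  rw [inner_ket, ket_apply]

theorem inner_incl_incl (v w : Fin0) (m : ℕ) (hv : ∀ n, m ≤ n → v n = 0) :
    inner ℂ (incl v) (incl w) = ∑ n ∈ Finset.range m, (starRingEnd ℂ) (v n) * w n := by
  rw [lp.inner_eq_tsum, tsum_eq_sum (s := Finset.range m)]
  · refine Finset.sum_congr rfl fun n _ => ?_
    rw [incl_apply, incl_apply, RCLike.inner_apply, mul_comm]
  · intro n hn
    rw [incl_apply, incl_apply, hv n (by simpa using hn), inner_zero_left]

theorem norm_incl_sq (v : Fin0) (m : ℕ) (hv : ∀ n, m ≤ n → v n = 0) :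
    ‖incl v‖ ^ 2 = ∑ n ∈ Finset.range m, ‖v n‖ ^ 2 := by
  have h := inner_self_eq_norm_sq_to_K (𝕜 := ℂ) (incl v)
  rw [inner_incl_incl v v m hv] at h
  have h2 : ((‖incl v‖ ^ 2 : ℝ) : ℂ) = ((∑ n ∈ Finset.range m, ‖v n‖ ^ 2 : ℝ) : ℂ) := by
    push_cast
    rw [← Complex.coe_algebraMap, ← h]
    refine Finset.sum_congr rfl fun n _ => ?_
    rw [← Complex.normSq_eq_conj_mul_self, Complex.normSq_eq_norm_sq]; push_cast; rfl
  exact_mod_cast h2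

theorem denseRange_incl : DenseRange incl := by
  intro x
  have h := lp.hasSum_single (p := 2) (by simp) x
  refine mem_closure_of_tendsto h (Eventually.of_forall fun s => ?_)
  refine ⟨∑ n ∈ s, Finsupp.single n ((x : ℕ → ℂ) n), ?_⟩
  rw [map_sum]
  refine Finset.sum_congr rfl fun n _ => ?_
  rw [incl_single]
  ext k
  simp [ket, lp.single_apply, Pi.single_apply]

theorem clm_ext_incl {S T : Fock →L[ℂ] Fock} (h : ∀ v, S (incl v) = T (incl v)) : S = T := by
  have : (S : Fock → Fock) = T :=
    denseRange_incl.equalizer S.continuous T.continuous (funext h)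
  exact DFunLike.coe_injective this

theorem clm_ext_ket {S T : Fock →L[ℂ] Fock} (h : ∀ n, S (ket n) = T (ket n)) : S = T := by
  refine clm_ext_incl fun v => ?_
  induction v using Finsupp.induction_linear with
  | zero => simp
  | add f g hf hg => simp [hf, hg]
  | single n z => simp [incl_single, h]

theorem ann_apply (v : Fin0) (k : ℕ) : ann v k = (Real.sqrt ((k : ℝ) + 1) : ℂ) * v (k + 1) := by
  induction v using Finsupp.induction_linear with
  | zero => simp
  | add f g hf hg => simp [hf, hg, mul_add]
  | single n z =>
    rcases n with _ | n
    · simp [ann]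
    · by_cases h : n = k
      · simp [ann, h, mul_comm]
      · simp [ann, h]

theorem cre_apply_zero (v : Fin0) : cre v 0 = 0 := by
  induction v using Finsupp.induction_linear with
  | zero => simp
  | add f g hf hg => simp [hf, hg]
  | single n z => simp [cre]

theorem cre_apply_succ (v : Fin0) (k : ℕ) :
    cre v (k + 1) = (Real.sqrt ((k : ℝ) + 1) : ℂ) * v k := by
  induction v using Finsupp.induction_linear with
  | zero => simp
  | add f g hf hg => simp [hf, hg, mul_add]
  | single n z =>
    by_cases h : n = k
    · simp [cre, h, mul_comm]
    · simp [cre, h]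

theorem ann_mul_cre_apply (v : Fin0) (k : ℕ) : (ann * cre) v k = ((k : ℂ) + 1) * v k := by
  rw [Module.End.mul_apply, ann_apply, cre_apply_succ, ← mul_assoc, ← Complex.ofReal_mul,
    Real.mul_self_sqrt (by positivity)]
  push_cast; rfl

theorem cre_mul_ann_apply (v : Fin0) (k : ℕ) : (cre * ann) v k = (k : ℂ) * v k := by
  rw [Module.End.mul_apply]
  rcases k with _ | k
  · simp [cre_apply_zero]
  · rw [cre_apply_succ, ann_apply, ← mul_assoc, ← Complex.ofReal_mul,
      Real.mul_self_sqrt (by positivity)]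
    push_cast; rfl

theorem ann_mul_cre : ann * cre = cre * ann + 1 := by
  ext1 n; ext1
  rw [Finsupp.ext_iff]
  intro k
  simp only [LinearMap.comp_apply, LinearMap.add_apply, Finsupp.add_apply, ann_mul_cre_apply,
    cre_mul_ann_apply, Module.End.one_apply]
  ring

theorem numHalf_apply (v : Fin0) (k : ℕ) : numHalf v k = ((k : ℂ) + 1 / 2) * v k := by
  simp only [numHalf, LinearMap.add_apply, Finsupp.add_apply, cre_mul_ann_apply,
    LinearMap.smul_apply, Finsupp.smul_apply, Module.End.one_apply, smul_eq_mul]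
  ring

theorem numHalf_single (n : ℕ) (z : ℂ) :
    numHalf (Finsupp.single n z) = ((n : ℂ) + 1 / 2) • Finsupp.single n z := by
  ext k
  rw [numHalf_apply, Finsupp.smul_apply, smul_eq_mul, Finsupp.single_apply]
  split_ifs with h
  · rw [h]
  · simp

theorem end_neg_eq_smul (A : Module.End ℂ Fin0) : -A = (-1 : ℂ) • A := by
  ext; simp

theorem end_sub_eq_add_smul (A B : Module.End ℂ Fin0) : A - B = A + (-1 : ℂ) • B := by
  ext; simp [sub_eq_add_neg]

/-! ### Formal adjoints -/

/-- `B` is a formal adjoint of `A` on finite linear combinations of number states. -/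
def IsAdj (A B : Module.End ℂ Fin0) : Prop :=
  ∀ v w, inner ℂ (incl (A v)) (incl w) = inner ℂ (incl v) (incl (B w))

theorem IsAdj.symm {A B : Module.End ℂ Fin0} (h : IsAdj A B) : IsAdj B A := fun v w => by
  rw [← inner_conj_symm, ← h w v, inner_conj_symm]

theorem IsAdj.add {A B A' B' : Module.End ℂ Fin0} (h : IsAdj A B) (h' : IsAdj A' B') :
    IsAdj (A + A') (B + B') := fun v w => by
  rw [LinearMap.add_apply, LinearMap.add_apply, map_add, map_add, inner_add_left, inner_add_right,
    h, h']

theorem IsAdj.sub {A B A' B' : Module.End ℂ Fin0} (h : IsAdj A B) (h' : IsAdj A' B') :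
    IsAdj (A - A') (B - B') := fun v w => by
  rw [LinearMap.sub_apply, LinearMap.sub_apply, map_sub, map_sub, inner_sub_left, inner_sub_right,
    h, h']

theorem IsAdj.smul {A B : Module.End ℂ Fin0} (h : IsAdj A B) (z : ℂ) :
    IsAdj (z • A) ((starRingEnd ℂ) z • B) := fun v w => by
  rw [LinearMap.smul_apply, LinearMap.smul_apply, map_smul, map_smul, inner_smul_left,
    inner_smul_right, h]

theorem IsAdj.mul {A B A' B' : Module.End ℂ Fin0} (h : IsAdj A B) (h' : IsAdj A' B') :
    IsAdj (A * A') (B' * B) := fun v w => by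
  simp only [Module.End.mul_apply]
  rw [h, h']

theorem isAdj_one : IsAdj 1 1 := fun _ _ => rfl

theorem exists_bound_support (v : Fin0) : ∃ m, ∀ n, m ≤ n → v n = 0 := by
  refine ⟨v.support.sup id + 1, fun n hn => ?_⟩
  by_contra h
  have := Finset.le_sup (f := id) (Finsupp.mem_support_iff.2 h)
  simp only [id] at this
  omega

theorem isAdj_ann_cre : IsAdj ann cre := fun v w => by
  obtain ⟨m, hm⟩ := exists_bound_support v
  -- The zeroth component of `cre w` vanishes, so splitting it off shifts the index by one and
  -- matches the two sums.
  rw [inner_incl_incl (ann v) w m (fun n hn => by rw [ann_apply, hm _ (by omega), mul_zero]),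
    inner_incl_incl v (cre w) (m + 1) (fun n hn => hm _ (by omega)), Finset.sum_range_succ',
    cre_apply_zero, mul_zero, add_zero]
  refine Finset.sum_congr rfl fun n _ => ?_
  rw [ann_apply, cre_apply_succ, map_mul, Complex.conj_ofReal]
  ring

theorem isAdj_numHalf : IsAdj numHalf numHalf := by
  have h := (isAdj_ann_cre.symm.mul isAdj_ann_cre).add (isAdj_one.smul (1 / 2))
  have e : (starRingEnd ℂ) (1 / 2 : ℂ) = 1 / 2 := by simp [Complex.conj_ofNat]
  rw [e] at h
  exact h

/-! ### Growth bounds and analytic vectors -/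

/-- `A` raises the degree by at most one, with the growth of the ladder operators. -/
def LinGrowth (A : Module.End ℂ Fin0) : Prop :=
  ∃ c : ℝ, 0 ≤ c ∧ ∀ (m : ℕ) (v : Fin0), (∀ n, m ≤ n → v n = 0) →
    (∀ n, m + 1 ≤ n → A v n = 0) ∧ ‖incl (A v)‖ ≤ c * Real.sqrt (m + 1) * ‖incl v‖

/-- `A` raises the degree by at most two and has norm at most `c (m + 1)` on degrees
below `m`. -/
def QuadGrowthWith (c : ℝ) (A : Module.End ℂ Fin0) : Prop :=
  ∀ (m : ℕ) (v : Fin0), (∀ n, m ≤ n → v n = 0) →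
    (∀ n, m + 2 ≤ n → A v n = 0) ∧ ‖incl (A v)‖ ≤ c * (m + 1) * ‖incl v‖

/-- `A` grows at most like a quadratic polynomial in the ladder operators. -/
def QuadGrowth (A : Module.End ℂ Fin0) : Prop := ∃ c : ℝ, 0 ≤ c ∧ QuadGrowthWith c A

theorem linGrowth_ann : LinGrowth ann := by
  refine ⟨1, zero_le_one, fun m v hv => ?_⟩
  have h1 : ∀ n, m ≤ n → ann v n = 0 := fun n hn => by
    rw [ann_apply, hv _ (by omega), mul_zero]
  refine ⟨fun n hn => h1 n (by omega), ?_⟩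
  rw [one_mul]
  refine le_of_sq_le_sq ?_ (by positivity)
  rw [mul_pow, Real.sq_sqrt (by positivity), norm_incl_sq _ m h1,
    norm_incl_sq v (m + 1) (fun n hn => hv n (by omega)), Finset.sum_range_succ', mul_add,
    Finset.mul_sum]
  refine le_add_of_le_of_nonneg (Finset.sum_le_sum fun n hn => ?_) (by positivity)
  rw [ann_apply, norm_mul, mul_pow, Complex.norm_real, Real.norm_of_nonneg (by positivity),
    Real.sq_sqrt (by positivity)]
  have : (n : ℝ) ≤ m := by exact_mod_cast (Finset.mem_range.1 hn).le
  gcongr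

theorem linGrowth_cre : LinGrowth cre := by
  refine ⟨1, zero_le_one, fun m v hv => ?_⟩
  have h1 : ∀ n, m + 1 ≤ n → cre v n = 0 := fun n hn => by
    obtain ⟨k, rfl⟩ : ∃ k, n = k + 1 := ⟨n - 1, by omega⟩
    rw [cre_apply_succ, hv _ (by omega), mul_zero]
  refine ⟨h1, ?_⟩
  rw [one_mul]
  refine le_of_sq_le_sq ?_ (by positivity)
  rw [mul_pow, Real.sq_sqrt (by positivity), norm_incl_sq _ (m + 1) h1,
    norm_incl_sq v m hv, Finset.sum_range_succ', cre_apply_zero, Finset.mul_sum]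
  simp only [norm_zero, ne_eq, OfNat.ofNat_ne_zero, not_false_eq_true, zero_pow, add_zero]
  refine Finset.sum_le_sum fun n hn => ?_
  rw [cre_apply_succ, norm_mul, mul_pow, Complex.norm_real, Real.norm_of_nonneg (by positivity),
    Real.sq_sqrt (by positivity)]
  have : (n : ℝ) ≤ m := by exact_mod_cast (Finset.mem_range.1 hn).le
  gcongr

theorem LinGrowth.quadGrowth {A : Module.End ℂ Fin0} (h : LinGrowth A) : QuadGrowth A := by
  obtain ⟨c, hc, h⟩ := h
  refine ⟨c, hc, fun m v hv => ⟨fun n hn => (h m v hv).1 n (by omega), (h m v hv).2.trans ?_⟩⟩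
  have : Real.sqrt ((m : ℝ) + 1) ≤ (m : ℝ) + 1 := by
    rw [Real.sqrt_le_left (by positivity)]
    nlinarith [(Nat.cast_nonneg m : (0 : ℝ) ≤ m)]
  gcongr

theorem LinGrowth.mul {A B : Module.End ℂ Fin0} (hA : LinGrowth A) (hB : LinGrowth B) :
    QuadGrowth (A * B) := by
  obtain ⟨c, hc, hA⟩ := hA
  obtain ⟨d, hd, hB⟩ := hB
  refine ⟨c * d * 2, by positivity, fun m v hv => ?_⟩
  obtain ⟨h1, h2⟩ := hB m v hv
  obtain ⟨h3, h4⟩ := hA (m + 1) (B v) h1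
  refine ⟨h3, h4.trans ?_⟩
  have hs : Real.sqrt (((m + 1 : ℕ) : ℝ) + 1) ≤ 2 * Real.sqrt ((m : ℝ) + 1) := by
    rw [Real.sqrt_le_left (by positivity), mul_pow, Real.sq_sqrt (by positivity)]
    push_cast; nlinarith [(Nat.cast_nonneg m : (0 : ℝ) ≤ m)]
  calc c * Real.sqrt (((m + 1 : ℕ) : ℝ) + 1) * ‖incl (B v)‖
      ≤ c * (2 * Real.sqrt ((m : ℝ) + 1)) * (d * Real.sqrt ((m : ℝ) + 1) * ‖incl v‖) := by gcongr
    _ = c * d * 2 * (Real.sqrt ((m : ℝ) + 1) * Real.sqrt ((m : ℝ) + 1)) * ‖incl v‖ := by ring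
    _ = _ := by rw [Real.mul_self_sqrt (by positivity)]

theorem QuadGrowth.add {A B : Module.End ℂ Fin0} (hA : QuadGrowth A) (hB : QuadGrowth B) :
    QuadGrowth (A + B) := by
  obtain ⟨c, hc, hA⟩ := hA
  obtain ⟨d, hd, hB⟩ := hB
  refine ⟨c + d, by positivity, fun m v hv => ⟨fun n hn => ?_, ?_⟩⟩
  · simp [(hA m v hv).1 n hn, (hB m v hv).1 n hn]
  · rw [LinearMap.add_apply, map_add]
    refine (norm_add_le _ _).trans ((add_le_add (hA m v hv).2 (hB m v hv).2).trans (le_of_eq ?_))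
    ring

theorem QuadGrowth.smul {A : Module.End ℂ Fin0} (hA : QuadGrowth A) (z : ℂ) :
    QuadGrowth (z • A) := by
  obtain ⟨c, hc, hA⟩ := hA
  refine ⟨‖z‖ * c, by positivity, fun m v hv => ⟨fun n hn => ?_, ?_⟩⟩
  · simp [(hA m v hv).1 n hn]
  · rw [LinearMap.smul_apply, map_smul, norm_smul, mul_assoc, mul_assoc]
    gcongr
    rw [← mul_assoc]
    exact (hA m v hv).2

theorem QuadGrowth.neg {A : Module.End ℂ Fin0} (hA : QuadGrowth A) : QuadGrowth (-A) := by
  rw [end_neg_eq_smul]; exact hA.smul _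

theorem QuadGrowth.sub {A B : Module.End ℂ Fin0} (hA : QuadGrowth A) (hB : QuadGrowth B) :
    QuadGrowth (A - B) := by
  rw [end_sub_eq_add_smul]; exact hA.add (hB.smul _)

theorem quadGrowth_one : QuadGrowth 1 := by
  refine ⟨1, zero_le_one, fun m v hv => ⟨fun n hn => hv n (by omega), ?_⟩⟩
  have : (0 : ℝ) ≤ m := Nat.cast_nonneg m
  rw [Module.End.one_apply]
  nlinarith [norm_nonneg (incl v)]

theorem quadGrowth_numHalf : QuadGrowth numHalf :=
  (linGrowth_cre.mul linGrowth_ann).add (quadGrowth_one.smul _)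

theorem quadGrowth_squeezeGen (ζ : ℂ) : QuadGrowth (squeezeGen ζ) := by
  unfold squeezeGen
  rw [sq, sq]
  exact ((linGrowth_ann.mul linGrowth_ann).smul _).sub ((linGrowth_cre.mul linGrowth_cre).smul _)

theorem isAdj_squeezeGen (ζ : ℂ) : IsAdj (squeezeGen ζ) (-squeezeGen ζ) := by
  have h := ((isAdj_ann_cre.mul isAdj_ann_cre).smul ((1 / 2 : ℂ) * (starRingEnd ℂ) ζ)).sub
    ((isAdj_ann_cre.symm.mul isAdj_ann_cre.symm).smul ((1 / 2 : ℂ) * ζ))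
  have e : -squeezeGen ζ = (starRingEnd ℂ) ((1 / 2 : ℂ) * (starRingEnd ℂ) ζ) • (cre * cre)
      - (starRingEnd ℂ) ((1 / 2 : ℂ) * ζ) • (ann * ann) := by
    simp only [squeezeGen, sq, map_mul, map_div₀, map_one, Complex.conj_ofNat, Complex.conj_conj]
    abel
  rw [e]
  simp only [squeezeGen, sq]
  exact h

theorem isAdj_rotationGen (θ : ℝ) : IsAdj (rotationGen θ) (-rotationGen θ) := by
  have h := isAdj_numHalf.smul (-(Complex.I * (θ : ℂ)))
  have e : -rotationGen θ = (starRingEnd ℂ) (-(Complex.I * (θ : ℂ))) • numHalf := by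
    rw [rotationGen, end_neg_eq_smul, smul_smul]
    congr 1
    simp
  rw [e]
  exact h

/-- Iterates of an operator of quadratic growth. -/
theorem QuadGrowthWith.iterate {c : ℝ} (hc : 0 ≤ c) {G : Module.End ℂ Fin0}
    (hG : QuadGrowthWith c G) (m : ℕ) (v : Fin0) (hv : ∀ n, m ≤ n → v n = 0) (n : ℕ) :
    (∀ k, m + 2 * n ≤ k → (G ^ n) v k = 0) ∧
      ‖incl ((G ^ n) v)‖ ≤ (2 * c) ^ n * ((m + n).factorial / m.factorial) * ‖incl v‖ := by
  induction n with
  | zero =>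
    refine ⟨fun k hk => by simpa using hv k (by omega), ?_⟩
    have : ((m.factorial : ℕ) : ℝ) ≠ 0 := by positivity
    simp [this]
  | succ n ih =>
    obtain ⟨h1, h2⟩ := ih
    obtain ⟨h3, h4⟩ := hG _ _ h1
    rw [pow_succ', Module.End.mul_apply]
    refine ⟨fun k hk => h3 k (by omega), h4.trans ?_⟩
    -- After `n` steps the degree is below `m + 2n`; up to a factor 2 the next bound is the next
    -- factor of `(m + n + 1)!`.
    have hm : (((m + 2 * n : ℕ) : ℝ) + 1) ≤ 2 * ((m : ℝ) + n + 1) := by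
      push_cast; nlinarith [(Nat.cast_nonneg m : (0 : ℝ) ≤ m)]
    calc c * (((m + 2 * n : ℕ) : ℝ) + 1) * ‖incl ((G ^ n) v)‖
        ≤ c * (2 * ((m : ℝ) + n + 1)) *
          ((2 * c) ^ n * ((m + n).factorial / m.factorial) * ‖incl v‖) := by gcongr
      _ = _ := by
        rw [← add_assoc, Nat.factorial_succ]
        push_cast; ring

/-- The quotient is `n!` times a binomial coefficient, which is at most `2 ^ (m + n)`. This loses
only geometric factors, harmless for analyticity. -/
theorem factorial_add_div_le (m n : ℕ) :
    ((m + n).factorial : ℝ) / m.factorial ≤ 2 ^ m * (n.factorial * 2 ^ n) := by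
  rw [div_le_iff₀ (by positivity)]
  have h : (m + n).factorial = (m + n).choose m * m.factorial * n.factorial := by
    have := Nat.choose_mul_factorial_mul_factorial (Nat.le_add_right m n)
    rw [Nat.add_sub_cancel_left] at this
    exact this.symm
  have h2 : (((m + n).choose m : ℕ) : ℝ) ≤ 2 ^ (m + n) := by
    exact_mod_cast Nat.choose_le_two_pow (m + n) m
  rw [h]; push_cast
  calc (((m + n).choose m : ℕ) : ℝ) * m.factorial * n.factorial
      ≤ 2 ^ (m + n) * m.factorial * n.factorial := by gcongr
    _ = _ := by rw [pow_add]; ring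

theorem QuadGrowthWith.iterate_le {c : ℝ} (hc : 0 ≤ c) {G : Module.End ℂ Fin0}
    (hG : QuadGrowthWith c G) (m : ℕ) (v : Fin0) (hv : ∀ n, m ≤ n → v n = 0) (n : ℕ) :
    ‖incl ((G ^ n) v)‖ ≤ 2 ^ m * ‖incl v‖ * n.factorial * (4 * c) ^ n := by
  refine (hG.iterate hc m v hv n).2.trans ?_
  calc (2 * c) ^ n * (((m + n).factorial : ℝ) / m.factorial) * ‖incl v‖
      ≤ (2 * c) ^ n * (2 ^ m * (n.factorial * 2 ^ n)) * ‖incl v‖ := by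
        gcongr; exact factorial_add_div_le m n
    _ = 2 ^ m * ‖incl v‖ * n.factorial * ((2 * c) ^ n * 2 ^ n) := by ring
    _ = _ := by rw [← mul_pow]; ring_nf

/-- Finite combinations of number states are analytic vectors, also after applying an operator of
quadratic growth. -/
theorem QuadGrowth.analytic {G A : Module.End ℂ Fin0} (hG : QuadGrowth G) (hA : QuadGrowth A) :
    ∃ R : ℝ, 0 < R ∧ ∀ v, ∃ C : ℝ, 0 ≤ C ∧
      ∀ n : ℕ, ‖incl (A ((G ^ n) v))‖ ≤ C * n.factorial * R ^ n := by
  obtain ⟨c, hc, hG⟩ := hG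
  obtain ⟨d, hd, hA⟩ := hA
  -- The degree factor `m + 2n + 1` of `A` costs `2 ^ n` and turns the rate `4c` into `8c`; the `+
  -- 1` keeps the rate positive when `c = 0`.
  refine ⟨8 * c + 1, by positivity, fun v => ?_⟩
  obtain ⟨m, hm⟩ := exists_bound_support v
  refine ⟨d * (m + 1) * 2 * (2 ^ m * ‖incl v‖), by positivity, fun n => ?_⟩
  refine (hA _ _ (hG.iterate hc m v hm n).1).2.trans ?_
  have h1 : (((m + 2 * n : ℕ) : ℝ) + 1) ≤ (m + 1) * 2 * 2 ^ n := by
    have h : ((n : ℝ) + 1) ≤ 2 ^ n := by exact_mod_cast Nat.lt_two_pow_self (n := n)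
    have hm0 : (0 : ℝ) ≤ m := Nat.cast_nonneg m
    have hn0 : (0 : ℝ) ≤ n := Nat.cast_nonneg n
    push_cast
    nlinarith [mul_nonneg hm0 hn0, mul_le_mul_of_nonneg_left h hm0]
  have h2 : (2 : ℝ) ^ n * (4 * c) ^ n ≤ (8 * c + 1) ^ n := by
    rw [← mul_pow]
    exact pow_le_pow_left₀ (by positivity) (by linarith) n
  calc d * (((m + 2 * n : ℕ) : ℝ) + 1) * ‖incl ((G ^ n) v)‖
      ≤ d * ((m + 1) * 2 * 2 ^ n) * (2 ^ m * ‖incl v‖ * n.factorial * (4 * c) ^ n) := by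
        gcongr
        exact hG.iterate_le hc m v hm n
    _ = d * (m + 1) * 2 * (2 ^ m * ‖incl v‖) * n.factorial * (2 ^ n * (4 * c) ^ n) := by ring
    _ ≤ _ := by gcongr

/-! ### A quasi-analytic vanishing lemma -/

section Vanishing

variable {E : Type*} [NormedAddCommGroup E] [NormedSpace ℝ E]

/-- Each induction step integrates the bound for `φ (n + 1)` from `a`, where everything vanishes;
after `k` steps this is the Taylor remainder of order `k`. -/
theorem norm_le_of_iterated_deriv {φ : ℕ → ℝ → E} {a T C R : ℝ}
    (hc : ∀ n, ContinuousOn (φ n) (Set.Icc a T))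
    (hd : ∀ n, ∀ t ∈ Set.Ico a T, HasDerivWithinAt (φ n) (φ (n + 1) t) (Set.Ici t) t)
    (h0 : ∀ n, φ n a = 0)
    (hb : ∀ n, ∀ t ∈ Set.Icc a T, ‖φ n t‖ ≤ C * n.factorial * R ^ n) (k : ℕ) :
    ∀ n, ∀ t ∈ Set.Icc a T,
      ‖φ n t‖ ≤ C * (n + k).factorial * R ^ (n + k) * ((t - a) ^ k / k.factorial) := by
  induction k with
  | zero => intro n t ht; simpa using hb n t ht
  | succ k ih =>
    intro n t ht
    have hB : ∀ x : ℝ, HasDerivAt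
        (fun x => C * (n + (k + 1)).factorial * R ^ (n + (k + 1)) *
          ((x - a) ^ (k + 1) / (k + 1).factorial))
        (C * (n + 1 + k).factorial * R ^ (n + 1 + k) * ((x - a) ^ k / k.factorial)) x := by
      intro x
      have h1 : HasDerivAt (fun x : ℝ => (x - a) ^ (k + 1)) (((k + 1 : ℕ) : ℝ) * (x - a) ^ k) x := by
        simpa using ((hasDerivAt_id x).sub_const a).fun_pow (k + 1)
      refine ((h1.div_const ((k + 1).factorial : ℝ)).const_mul
        (C * (n + (k + 1)).factorial * R ^ (n + (k + 1)))).congr_deriv ?_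
      rw [show n + 1 + k = n + (k + 1) by ring, Nat.factorial_succ k]
      have : ((k.factorial : ℕ) : ℝ) ≠ 0 := by positivity
      have h2 : ((k + 1 : ℕ) : ℝ) ≠ 0 := by positivity
      push_cast at h2 ⊢
      field_simp
    refine image_norm_le_of_norm_deriv_right_le_deriv_boundary (hc n) (hd n) ?_ hB ?_ ht
    · simp [h0]
    · intro x hx
      exact ih (n + 1) x ⟨hx.1, hx.2.le⟩

/-- Since `(n + k)! / k! ≤ 2 ^ k * (n! * 2 ^ n)`, the remainder is at most a constant times `(2 R (t
- a)) ^ k`, which tends to zero on this interval. -/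
theorem eq_zero_of_iterated_deriv_of_small {φ : ℕ → ℝ → E} {a T C R : ℝ} (hC : 0 ≤ C) (hR : 0 < R)
    (hc : ∀ n, ContinuousOn (φ n) (Set.Icc a T))
    (hd : ∀ n, ∀ t ∈ Set.Ico a T, HasDerivWithinAt (φ n) (φ (n + 1) t) (Set.Ici t) t)
    (h0 : ∀ n, φ n a = 0)
    (hb : ∀ n, ∀ t ∈ Set.Icc a T, ‖φ n t‖ ≤ C * n.factorial * R ^ n) (n : ℕ) (t : ℝ)
    (ht : t ∈ Set.Icc a T) (hs : R * (t - a) ≤ 1 / 4) : φ n t = 0 := by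
  have hlim : Tendsto (fun k : ℕ => C * n.factorial * (2 * R) ^ n * (1 / 2 : ℝ) ^ k) atTop
      (𝓝 (C * n.factorial * (2 * R) ^ n * 0)) :=
    (tendsto_pow_atTop_nhds_zero_of_lt_one (by norm_num) (by norm_num)).const_mul _
  rw [mul_zero] at hlim
  have ht0 : 0 ≤ t - a := sub_nonneg.2 ht.1
  have hle : ∀ k : ℕ, ‖φ n t‖ ≤ C * n.factorial * (2 * R) ^ n * (1 / 2 : ℝ) ^ k := by
    intro k
    refine (norm_le_of_iterated_deriv hc hd h0 hb k n t ht).trans ?_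
    have h1 : ((k + n).factorial : ℝ) / k.factorial ≤ 2 ^ k * (n.factorial * 2 ^ n) :=
      factorial_add_div_le k n
    have h2 : (R * (t - a)) ^ k ≤ (1 / 4) ^ k := pow_le_pow_left₀ (by positivity) hs k
    calc C * (n + k).factorial * R ^ (n + k) * ((t - a) ^ k / k.factorial)
        = C * R ^ n * ((k + n).factorial / k.factorial) * (R * (t - a)) ^ k := by
          rw [add_comm n k, pow_add, mul_pow]; ring
      _ ≤ C * R ^ n * (2 ^ k * (n.factorial * 2 ^ n)) * (1 / 4) ^ k := by gcongr
      _ = C * n.factorial * (2 * R) ^ n * (2 * (1 / 4)) ^ k := by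
          rw [mul_pow, mul_pow]; ring
      _ = _ := by norm_num
  have := ge_of_tendsto' hlim hle
  exact norm_le_zero_iff.1 this

/-- A sequence of functions, each the derivative of its predecessor, that vanish at the initial
time and satisfy an analytic bound uniformly in time, vanishes. -/
theorem eq_zero_of_iterated_deriv {φ : ℕ → ℝ → E} {T C R : ℝ} (hC : 0 ≤ C) (hR : 0 < R)
    (hc : ∀ n, ContinuousOn (φ n) (Set.Icc 0 T))
    (hd : ∀ n, ∀ t ∈ Set.Ico 0 T, HasDerivWithinAt (φ n) (φ (n + 1) t) (Set.Ici t) t)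
    (h0 : ∀ n, φ n 0 = 0)
    (hb : ∀ n, ∀ t ∈ Set.Icc 0 T, ‖φ n t‖ ≤ C * n.factorial * R ^ n) (n : ℕ) (t : ℝ)
    (ht : t ∈ Set.Icc 0 T) : φ n t = 0 := by
  -- All `φ n` vanish at the end of each interval of length `1 / (4R)`, so the small-time argument
  -- restarts there.
  have key : ∀ k : ℕ, ∀ n, ∀ t ∈ Set.Icc 0 T, R * t ≤ k * (1 / 4) → φ n t = 0 := by
    intro k
    induction k with
    | zero =>
      intro n t ht h
      have : t = 0 := le_antisymm (by
        rw [Nat.cast_zero, zero_mul] at h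
        exact nonpos_of_mul_nonpos_right h hR) ht.1
      rw [this, h0]
    | succ k ih =>
      intro n t ht h
      by_cases hk : R * t ≤ k * (1 / 4)
      · exact ih n t ht hk
      · set a : ℝ := k * (1 / 4) / R with ha
        have haR : R * a = k * (1 / 4) := by rw [ha]; field_simp
        have ha0 : 0 ≤ a := by positivity
        have hat : a ≤ t := by
          by_contra hlt
          exact hk ((mul_le_mul_of_nonneg_left (not_le.1 hlt).le hR.le).trans haR.le)
        refine eq_zero_of_iterated_deriv_of_small (a := a) (T := T) hC hR
          (fun n => (hc n).mono (Set.Icc_subset_Icc_left ha0))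
          (fun n s hs => hd n s ⟨ha0.trans hs.1, hs.2⟩)
          (fun n => ih n a ⟨ha0, hat.trans ht.2⟩ haR.le)
          (fun n s hs => hb n s ⟨ha0.trans hs.1, hs.2⟩) n t ⟨hat, ht.2⟩ ?_
        rw [mul_sub, haR]
        push_cast at h
        linarith
  obtain ⟨k, hk⟩ := exists_nat_ge (R * t * 4)
  exact key k n t ht (by linarith)

end Vanishing

/-! ### Uniqueness of the semigroup -/

theorem IsC0Semigroup.exists_bound {T : ℝ≥0 → (Fock →L[ℂ] Fock)} (hT : IsC0Semigroup T) (b : ℝ≥0) :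
    ∃ M : ℝ, 0 ≤ M ∧ ∀ t ≤ b, ‖T t‖ ≤ M := by
  obtain ⟨M, hM⟩ := banach_steinhaus (g := fun t : Set.Icc (0 : ℝ≥0) b => T t) (fun x => by
    obtain ⟨C, hC⟩ := (isCompact_Icc (a := (0 : ℝ≥0)) (b := b)).exists_bound_of_continuousOn
      (hT.cont x).continuousOn
    exact ⟨C, fun t => hC t t.2⟩)
  exact ⟨M, (norm_nonneg _).trans (hM ⟨0, by simp⟩), fun t ht => hM ⟨t, by simp, ht⟩⟩

/-- The generator of the semigroup `T` extends `G`. -/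
def Generates (G : Module.End ℂ Fin0) (T : ℝ≥0 → (Fock →L[ℂ] Fock)) : Prop :=
  ∀ v : Fin0, Tendsto (fun t : ℝ≥0 => ((t : ℝ)⁻¹ : ℂ) • (T t (incl v) - incl v))
      (𝓝[>] 0) (𝓝 (incl (G v)))

/-- The operator `T t` is applied to the difference quotient at time zero. This gives only a right
derivative, which is all that the mean value inequality behind the vanishing lemma requires. -/
theorem IsC0Semigroup.hasDerivWithinAt {T : ℝ≥0 → (Fock →L[ℂ] Fock)} (hT : IsC0Semigroup T)
    {G : Module.End ℂ Fin0} (hG : Generates G T) (v : Fin0) (t : ℝ) (ht : 0 ≤ t) :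
    HasDerivWithinAt (fun s : ℝ => T s.toNNReal (incl v)) (T t.toNNReal (incl (G v)))
      (Set.Ici t) t := by
  rw [hasDerivWithinAt_iff_tendsto_slope, Set.Ici_sdiff_left]
  have h1 : Tendsto (fun s : ℝ => (s - t).toNNReal) (𝓝[>] t) (𝓝[>] 0) := by
    refine tendsto_nhdsWithin_iff.2 ⟨?_, ?_⟩
    · have : Continuous fun s : ℝ => (s - t).toNNReal := by fun_prop
      have h := this.tendsto t
      simp only [sub_self, Real.toNNReal_zero] at h
      exact h.mono_left nhdsWithin_le_nhds
    · filter_upwards [self_mem_nhdsWithin] with s hs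
      simpa using hs
  have h2 := ((T t.toNNReal).continuous.tendsto _).comp ((hG v).comp h1)
  refine h2.congr' ?_
  filter_upwards [self_mem_nhdsWithin] with s hs
  have hs : t < s := hs
  have hst : s.toNNReal = t.toNNReal + (s - t).toNNReal := by
    rw [← Real.toNNReal_add ht (by linarith)]; congr 1; ring
  simp only [Function.comp]
  rw [slope_def_module, hst, hT.add, mul_apply_eq_comp, ← map_sub,
    Real.coe_toNNReal _ (by linarith : (0 : ℝ) ≤ s - t), map_smul, ← Complex.ofReal_inv,
    Complex.coe_smul]
  rfl

theorem IsC0Semigroup.continuous_toNNReal {T : ℝ≥0 → (Fock →L[ℂ] Fock)} (hT : IsC0Semigroup T)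
    (ψ : Fock) : Continuous fun s : ℝ => T s.toNNReal ψ :=
  (hT.cont ψ).comp continuous_real_toNNReal

/-- The differences `T s (G ^ n v) - S s (G ^ n v)` are successive derivatives of one another,
vanish at `s = 0` and inherit the factorial bound of `G ^ n v`, so the vanishing lemma applies.
Density of the finite combinations finishes the argument. -/
theorem QuadGrowth.semigroup_unique {G : Module.End ℂ Fin0} (hG : QuadGrowth G)
    {T S : ℝ≥0 → (Fock →L[ℂ] Fock)} (hT : IsC0Semigroup T) (hTG : Generates G T)
    (hS : IsC0Semigroup S) (hSG : Generates G S) (t : ℝ≥0) : T t = S t := by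
  refine clm_ext_incl fun v => ?_
  obtain ⟨M, hM0, hM⟩ := hT.exists_bound t
  obtain ⟨N, hN0, hN⟩ := hS.exists_bound t
  obtain ⟨R, hR, hA⟩ := hG.analytic quadGrowth_one
  obtain ⟨C, hC0, hC⟩ := hA v
  have h := eq_zero_of_iterated_deriv
    (φ := fun n s => T s.toNNReal (incl ((G ^ n) v)) - S s.toNNReal (incl ((G ^ n) v)))
    (T := t) (C := (M + N) * C) (R := R) (by positivity) hR
    (fun n => ((hT.continuous_toNNReal _).sub (hS.continuous_toNNReal _)).continuousOn)
    (fun n s hs => by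
      rw [pow_succ', Module.End.mul_apply]
      exact (hT.hasDerivWithinAt hTG _ s hs.1).sub (hS.hasDerivWithinAt hSG _ s hs.1))
    (fun n => by simp [hT.zero, hS.zero])
    (fun n s hs => by
      have hs' : s.toNNReal ≤ t := Real.toNNReal_le_iff_le_coe.2 hs.2
      have h1 : ‖incl ((G ^ n) v)‖ ≤ C * n.factorial * R ^ n := hC n
      calc ‖T s.toNNReal (incl ((G ^ n) v)) - S s.toNNReal (incl ((G ^ n) v))‖
          ≤ ‖T s.toNNReal (incl ((G ^ n) v))‖ + ‖S s.toNNReal (incl ((G ^ n) v))‖ :=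
            norm_sub_le _ _
        _ ≤ M * (C * n.factorial * R ^ n) + N * (C * n.factorial * R ^ n) :=
            add_le_add ((T _).le_of_opNorm_le_of_le (hM _ hs') h1)
              ((S _).le_of_opNorm_le_of_le (hN _ hs') h1)
        _ = _ := by ring)
    0 t ⟨t.2, le_rfl⟩
  simpa [sub_eq_zero] using h

theorem isExp_iff_of_semigroup {G : Module.End ℂ Fin0} (hG : QuadGrowth G)
    {T : ℝ≥0 → (Fock →L[ℂ] Fock)} (hT : IsC0Semigroup T) (hTG : Generates G T)
    (E : Fock →L[ℂ] Fock) : IsExp G E ↔ E = T 1 := by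
  constructor
  · rintro ⟨S, hS, hSG, rfl⟩
    exact hG.semigroup_unique hS hSG hT hTG 1
  · rintro rfl
    exact ⟨T, hT, hTG, rfl⟩

theorem opExp_eq_of_semigroup {G : Module.End ℂ Fin0} (hG : QuadGrowth G)
    {T : ℝ≥0 → (Fock →L[ℂ] Fock)} (hT : IsC0Semigroup T) (hTG : Generates G T) :
    opExp G = T 1 := by
  have h : ∃ E, IsExp G E := ⟨T 1, (isExp_iff_of_semigroup hG hT hTG _).2 rfl⟩
  rw [opExp, dif_pos h]
  exact (isExp_iff_of_semigroup hG hT hTG _).1 h.choose_spec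

/-! ### Exponentials of bounded operators -/

section BoundedExp

variable {H : Type*} [NormedAddCommGroup H] [InnerProductSpace ℂ H] [CompleteSpace H]

theorem exp_add_smul (A : H →L[ℂ] H) (s t : ℂ) :
    NormedSpace.exp ((s + t) • A) = NormedSpace.exp (s • A) * NormedSpace.exp (t • A) := by
  let _ : NormedAlgebra ℚ (H →L[ℂ] H) := NormedAlgebra.restrictScalars ℚ ℂ _
  rw [add_smul]
  exact NormedSpace.exp_add_of_commute ((Commute.refl A).smul_left s |>.smul_right t)

theorem exp_smul_apply_hasSum (A : H →L[ℂ] H) (t : ℂ) (x : H) :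
    HasSum (fun n : ℕ => ((n.factorial : ℂ)⁻¹ * t ^ n) • (A ^ n) x)
      (NormedSpace.exp (t • A) x) := by
  have h := (ContinuousLinearMap.apply ℂ H x).hasSum
    (NormedSpace.exp_series_hasSum_exp' (𝕂 := ℂ) (t • A))
  refine h.congr_fun fun n => ?_
  simp [smul_pow, smul_smul]

theorem exp_smul_apply_hasDerivAt (A : H →L[ℂ] H) (x : H) (t : ℝ) :
    HasDerivAt (fun s : ℝ => NormedSpace.exp ((s : ℂ) • A) x)
      (A (NormedSpace.exp ((t : ℂ) • A) x)) t := by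
  have h := (ContinuousLinearMap.apply ℂ H x).hasFDerivAt.comp_hasDerivAt (t : ℂ)
    (hasDerivAt_exp_smul_const' (𝕂 := ℂ) A (t : ℂ))
  have h2 := h.scomp t (Complex.ofRealCLM.hasDerivAt (x := t))
  simpa [Function.comp_def] using h2

/-- The exponential of a dissipative bounded operator is a contraction at positive times. -/
theorem norm_exp_smul_apply_le (A : H →L[ℂ] H) (hA : ∀ x, (inner ℂ x (A x)).re ≤ 0) (x : H)
    {t : ℝ} (ht : 0 ≤ t) : ‖NormedSpace.exp ((t : ℂ) • A) x‖ ≤ ‖x‖ := by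
  set f : ℝ → H := fun s => NormedSpace.exp ((s : ℂ) • A) x with hf
  have hd : ∀ s, HasDerivAt f (A (f s)) s := exp_smul_apply_hasDerivAt A x
  have hg : ∀ s, HasDerivAt (fun s => (inner ℂ (f s) (f s)).re)
      (inner ℂ (f s) (A (f s)) + inner ℂ (A (f s)) (f s)).re s := fun s =>
    Complex.reCLM.hasFDerivAt.comp_hasDerivAt s ((hd s).inner ℂ (hd s))
  -- The derivative of `‖f s‖²` is twice the real part of `⟨f s, A (f s)⟩`.
  have hanti : Antitone fun s => (inner ℂ (f s) (f s)).re := by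
    refine antitone_of_deriv_nonpos (fun s => (hg s).differentiableAt) fun s => ?_
    rw [(hg s).deriv, Complex.add_re]
    have : (inner ℂ (A (f s)) (f s)).re = (inner ℂ (f s) (A (f s))).re := by
      rw [← inner_conj_symm, Complex.conj_re]
    rw [this]
    linarith [hA (f s)]
  have h := hanti ht
  have h0 : f 0 = x := by simp [hf]
  have hn : ∀ y : H, (inner ℂ y y).re = ‖y‖ ^ 2 := fun y => by
    have := inner_self_eq_norm_sq (𝕜 := ℂ) y
    simpa using this
  simp only [hn, h0] at h
  exact le_of_sq_le_sq h (norm_nonneg _)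

end BoundedExp
-- Truncations and construction of the semigroup
/-- Truncation of a vector to its first `N` components. -/
noncomputable def cut (N : ℕ) : Fock →ₗ[ℂ] Fin0 where
  toFun x := ∑ i ∈ Finset.range N, Finsupp.single i ((x : ℕ → ℂ) i)
  map_add' x y := by simp [Finset.sum_add_distrib]
  map_smul' z x := by simp [Finset.smul_sum]

theorem cut_apply (N : ℕ) (x : Fock) (k : ℕ) :
    cut N x k = if k < N then (x : ℕ → ℂ) k else 0 := by
  simp [cut, Finsupp.finsetSum_apply, Finsupp.single_apply]

theorem cut_incl_of_le {N m : ℕ} {v : Fin0} (hv : ∀ n, m ≤ n → v n = 0) (h : m ≤ N) :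
    cut N (incl v) = v := by
  ext k
  rw [cut_apply, incl_apply]
  split_ifs with hk
  · rfl
  · rw [hv k (by omega)]

theorem incl_cut (N : ℕ) (x : Fock) :
    incl (cut N x) = ∑ i ∈ Finset.range N, (x : ℕ → ℂ) i • ket i := by
  change incl (∑ i ∈ Finset.range N, Finsupp.single i ((x : ℕ → ℂ) i)) = _
  rw [map_sum]
  simp [incl_single]

theorem inner_incl_cut (N : ℕ) (x y : Fock) :
    inner ℂ (incl (cut N x)) y = inner ℂ x (incl (cut N y)) := by
  rw [incl_cut, incl_cut, sum_inner, inner_sum]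
  refine Finset.sum_congr rfl fun i _ => ?_
  rw [inner_smul_left, inner_smul_right, inner_ket, ← inner_conj_symm x, inner_ket, mul_comm]

theorem cut_incl_cut (N : ℕ) (x : Fock) : cut N (incl (cut N x)) = cut N x := by
  ext k
  simp only [cut_apply, incl_apply]
  split_ifs <;> rfl

/-- Truncation is a symmetric idempotent `P`, so `‖P x‖² = ⟨x, P x⟩` and Cauchy–Schwarz applies. -/
theorem norm_incl_cut_le (N : ℕ) (x : Fock) : ‖incl (cut N x)‖ ≤ ‖x‖ := by
  have h1 : ‖incl (cut N x)‖ * ‖incl (cut N x)‖ ≤ ‖x‖ * ‖incl (cut N x)‖ := by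
    have h := norm_inner_le_norm (𝕜 := ℂ) x (incl (cut N x))
    rw [← cut_incl_cut N x, ← inner_incl_cut, inner_self_eq_norm_sq_to_K, cut_incl_cut] at h
    simpa [sq] using h
  by_contra hlt
  push Not at hlt
  nlinarith [norm_nonneg x]

/-- The compression of an operator to the span of the first `N` number states. -/
noncomputable def trunc (G : Module.End ℂ Fin0) (N : ℕ) : Fock →L[ℂ] Fock :=
  ∑ j ∈ Finset.range N,
    InnerProductSpace.rankOne ℂ (incl (cut N (incl (G (Finsupp.single j 1))))) (ket j)

theorem trunc_apply (G : Module.End ℂ Fin0) (N : ℕ) (x : Fock) :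
    trunc G N x = incl (cut N (incl (G (cut N x)))) := by
  have h : cut N x = ∑ i ∈ Finset.range N, (x : ℕ → ℂ) i • Finsupp.single i (1 : ℂ) := by
    change ∑ i ∈ Finset.range N, Finsupp.single i ((x : ℕ → ℂ) i) = _
    simp
  conv_rhs => rw [h]
  simp only [trunc, map_sum, map_smul, sum_apply,
    InnerProductSpace.rankOne_apply, inner_ket]

theorem inner_trunc (G : Module.End ℂ Fin0) (N : ℕ) (x y : Fock) :
    inner ℂ x (trunc G N y) = inner ℂ (incl (cut N x)) (incl (G (cut N y))) := by
  rw [trunc_apply, inner_incl_cut]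

/-- The compression of an operator, as an operator on finite combinations of number states. -/
noncomputable def truncEnd (G : Module.End ℂ Fin0) (N : ℕ) : Module.End ℂ Fin0 :=
  (cut N ∘ₗ incl) * G * (cut N ∘ₗ incl)

theorem trunc_incl (G : Module.End ℂ Fin0) (N : ℕ) (v : Fin0) :
    trunc G N (incl v) = incl (truncEnd G N v) := by
  rw [trunc_apply]; rfl

theorem trunc_pow_incl (G : Module.End ℂ Fin0) (N n : ℕ) (v : Fin0) :
    (trunc G N ^ n) (incl v) = incl ((truncEnd G N ^ n) v) := by
  induction n with
  | zero => simp
  | succ n ih => rw [pow_succ', pow_succ', mul_apply_eq_comp, ih, trunc_incl]; rfl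

/-- The constant `c` does not depend on `N`; this is what makes the power series of the truncated
exponentials converge uniformly in `N`. -/
theorem QuadGrowthWith.truncEnd {c : ℝ} (hc : 0 ≤ c) {G : Module.End ℂ Fin0}
    (hG : QuadGrowthWith c G) (N : ℕ) : QuadGrowthWith c (truncEnd G N) := by
  intro m v hv
  have h1 : ∀ n, m ≤ n → cut N (incl v) n = 0 := fun n hn => by
    rw [cut_apply, incl_apply, hv n hn, ite_self]
  obtain ⟨h2, h3⟩ := hG m _ h1
  refine ⟨fun n hn => ?_, ?_⟩
  · change cut N (incl (G (cut N (incl v)))) n = 0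
    rw [cut_apply, incl_apply, h2 n hn, ite_self]
  · change ‖incl (cut N (incl (G (cut N (incl v)))))‖ ≤ _
    refine (norm_incl_cut_le _ _).trans (h3.trans ?_)
    gcongr
    exact norm_incl_cut_le _ _

theorem eventually_truncEnd (G : Module.End ℂ Fin0) (v : Fin0) :
    ∀ᶠ N in atTop, truncEnd G N v = G v := by
  obtain ⟨m, hm⟩ := exists_bound_support v
  obtain ⟨k, hk⟩ := exists_bound_support (G v)
  filter_upwards [eventually_ge_atTop m, eventually_ge_atTop k] with N h1 h2
  change cut N (incl (G (cut N (incl v)))) = G v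
  rw [cut_incl_of_le hm h1, cut_incl_of_le hk h2]

/-- The first `n` powers of `G` move `v` through finitely many levels only, so a large enough
truncation is not felt. -/
theorem eventually_truncEnd_pow (G : Module.End ℂ Fin0) (v : Fin0) (n : ℕ) :
    ∀ᶠ N in atTop, (truncEnd G N ^ n) v = (G ^ n) v := by
  induction n with
  | zero => simp
  | succ n ih =>
    filter_upwards [ih, eventually_truncEnd G ((G ^ n) v)] with N h1 h2
    rw [pow_succ', pow_succ', Module.End.mul_apply, Module.End.mul_apply, h1, h2]

/-- `G` is dissipative on finite linear combinations of number states. -/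
def Dissipative (G : Module.End ℂ Fin0) : Prop := ∀ v, (inner ℂ (incl v) (incl (G v))).re ≤ 0

theorem Dissipative.norm_exp_trunc_le {G : Module.End ℂ Fin0} (hG : Dissipative G) (N : ℕ)
    {t : ℝ} (ht : 0 ≤ t) (x : Fock) : ‖NormedSpace.exp ((t : ℂ) • trunc G N) x‖ ≤ ‖x‖ :=
  norm_exp_smul_apply_le _ (fun y => by rw [inner_trunc]; exact hG _) x ht

theorem norm_exp_term_le {C R δ : ℝ} (hδ : R * δ ≤ 1 / 2) (hR : 0 ≤ R)
    (hC : 0 ≤ C) {n : ℕ} {x : Fock} (hx : ‖x‖ ≤ C * n.factorial * R ^ n)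
    {t : ℝ} (ht : 0 ≤ t) (htδ : t ≤ δ) :
    ‖((n.factorial : ℂ)⁻¹ * (t : ℂ) ^ n) • x‖ ≤ C * (1 / 2) ^ n := by
  have hf : ((n.factorial : ℕ) : ℝ) ≠ 0 := by positivity
  rw [norm_smul, norm_mul, norm_inv, norm_pow, Complex.norm_natCast, Complex.norm_real,
    Real.norm_of_nonneg ht]
  calc ((n.factorial : ℝ))⁻¹ * t ^ n * ‖x‖
      ≤ ((n.factorial : ℝ))⁻¹ * t ^ n * (C * n.factorial * R ^ n) := by gcongr
    _ = C * (R * t) ^ n := by rw [mul_pow]; field_simp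
    _ ≤ C * (1 / 2) ^ n := by
      gcongr
      exact (mul_le_mul_of_nonneg_left htδ hR).trans hδ

/-- At small times the exponential of the truncations converges on number states to the
exponential series. -/
theorem QuadGrowthWith.tendsto_exp_trunc_incl {c : ℝ} (hc : 0 ≤ c) {G : Module.End ℂ Fin0}
    (hG : QuadGrowthWith c G) {t δ : ℝ} (hδ : 4 * c * δ ≤ 1 / 2) (ht : 0 ≤ t) (htδ : t ≤ δ)
    (v : Fin0) :
    Tendsto (fun N => NormedSpace.exp ((t : ℂ) • trunc G N) (incl v)) atTop
      (𝓝 (∑' n : ℕ, ((n.factorial : ℂ)⁻¹ * (t : ℂ) ^ n) • incl ((G ^ n) v))) := by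
  obtain ⟨m, hm⟩ := exists_bound_support v
  have h : ∀ N, NormedSpace.exp ((t : ℂ) • trunc G N) (incl v)
      = ∑' n : ℕ, ((n.factorial : ℂ)⁻¹ * (t : ℂ) ^ n) • (trunc G N ^ n) (incl v) := fun N =>
    (exp_smul_apply_hasSum _ _ _).tsum_eq.symm
  simp only [h]
  refine tendsto_tsum_of_dominated_convergence
    (bound := fun n => 2 ^ m * ‖incl v‖ * (1 / 2) ^ n)
    ((summable_geometric_of_lt_one (by norm_num) (by norm_num)).mul_left _) (fun n => ?_)
    (Eventually.of_forall fun N n => ?_)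
  · refine tendsto_const_nhds.congr' ?_
    filter_upwards [eventually_truncEnd_pow G v n] with N hN
    rw [trunc_pow_incl, hN]
  · rw [trunc_pow_incl]
    exact norm_exp_term_le hδ (by positivity) (by positivity)
      ((hG.truncEnd hc N).iterate_le hc m v hm n) ht htδ

theorem exists_tendsto_of_contraction {L : ℕ → (Fock →L[ℂ] Fock)} (hL : ∀ N x, ‖L N x‖ ≤ ‖x‖)
    (h : ∀ v, ∃ y, Tendsto (fun N => L N (incl v)) atTop (𝓝 y)) (x : Fock) :
    ∃ y, Tendsto (fun N => L N x) atTop (𝓝 y) := by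
  refine cauchySeq_tendsto_of_complete (Metric.cauchySeq_iff'.2 fun ε hε => ?_)
  obtain ⟨v, hv⟩ := denseRange_incl.exists_dist_lt x (show 0 < ε / 3 by positivity)
  obtain ⟨y, hy⟩ := h v
  obtain ⟨N₀, hN₀⟩ := Metric.cauchySeq_iff'.1 hy.cauchySeq (ε / 3) (by positivity)
  refine ⟨N₀, fun N hN => ?_⟩
  have h1 : ∀ N, dist (L N x) (L N (incl v)) < ε / 3 := fun N => by
    rw [dist_eq_norm, ← map_sub]
    exact (hL N _).trans_lt (by rwa [← dist_eq_norm])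
  have h2 := dist_triangle4 (L N x) (L N (incl v)) (L N₀ (incl v)) (L N₀ x)
  have h3 := h1 N₀
  rw [dist_comm] at h3
  linarith [h1 N, hN₀ N hN]

theorem tendsto_apply_of_contraction {L : ℕ → (Fock →L[ℂ] Fock)} (hL : ∀ N x, ‖L N x‖ ≤ ‖x‖)
    {x : ℕ → Fock} {y z : Fock} (hx : Tendsto x atTop (𝓝 y))
    (hy : Tendsto (fun N => L N y) atTop (𝓝 z)) :
    Tendsto (fun N => L N (x N)) atTop (𝓝 z) := by
  have h1 : Tendsto (fun N => L N (x N - y)) atTop (𝓝 0) :=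
    squeeze_zero_norm (fun N => hL N _) (tendsto_iff_norm_sub_tendsto_zero.1 hx)
  have h2 := h1.add hy
  simpa using h2

/-- At small times the series converges on finite combinations, and contractivity extends the limit
to all vectors. An arbitrary time is a multiple of a small one, and strong limits of contractions
may be composed. -/
theorem QuadGrowth.exists_tendsto_exp_trunc {G : Module.End ℂ Fin0} (hG : QuadGrowth G)
    (hd : Dissipative G) (t : ℝ≥0) (x : Fock) :
    ∃ y, Tendsto (fun N => NormedSpace.exp (((t : ℝ) : ℂ) • trunc G N) x) atTop (𝓝 y) := by
  obtain ⟨c, hc, hG⟩ := hG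
  -- Chosen to make the series dominated by powers of `1/2`; the `+ 1` covers `c = 0`.
  set δ : ℝ := 1 / (2 * (4 * c + 1)) with hδ
  have hδ0 : 0 < δ := by positivity
  have hcδ : 4 * c * δ ≤ 1 / 2 := by
    rw [hδ, mul_one_div, div_le_div_iff₀ (by positivity) (by norm_num)]; linarith
  have small : ∀ s : ℝ, 0 ≤ s → s ≤ δ → ∀ x,
      ∃ y, Tendsto (fun N => NormedSpace.exp ((s : ℂ) • trunc G N) x) atTop (𝓝 y) :=
    fun s hs hsδ => exists_tendsto_of_contraction (fun N x => hd.norm_exp_trunc_le N hs x)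
      fun v => ⟨_, hG.tendsto_exp_trunc_incl hc hcδ hs hsδ v⟩
  have all : ∀ k : ℕ, ∀ s : ℝ, 0 ≤ s → s ≤ δ → ∀ x,
      ∃ y, Tendsto (fun N => NormedSpace.exp (((k * s : ℝ) : ℂ) • trunc G N) x) atTop (𝓝 y) := by
    intro k s hs hsδ
    induction k with
    | zero => intro x; exact ⟨x, by simp⟩
    | succ k ih =>
      intro x
      obtain ⟨y, hy⟩ := ih x
      obtain ⟨z, hz⟩ := small s hs hsδ y
      refine ⟨z, ?_⟩
      have := tendsto_apply_of_contraction (fun N x => hd.norm_exp_trunc_le N hs x) hy hz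
      refine this.congr fun N => ?_
      rw [← mul_apply_eq_comp, ← exp_add_smul]
      congr 3
      push_cast; ring
  obtain ⟨k, hk⟩ := exists_nat_gt ((t : ℝ) / δ)
  have hk0 : (0 : ℝ) < k := lt_of_le_of_lt (by positivity) hk
  obtain ⟨y, hy⟩ := all k (t / k) (by positivity) (by
    rw [div_lt_iff₀ hδ0] at hk
    rw [div_le_iff₀ hk0]
    linarith) x
  refine ⟨y, ?_⟩
  rwa [mul_div_cancel₀ _ hk0.ne'] at hy

/-- By the semigroup law and contractivity, `‖T s x - T t x‖` is at most `‖T |s - t| x - x‖`, so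
continuity at zero suffices, and by density only on finite combinations. -/
theorem isC0Semigroup_of_contraction {T : ℝ≥0 → (Fock →L[ℂ] Fock)} (h0 : T 0 = 1)
    (hadd : ∀ s t, T (s + t) = T s * T t) (hle : ∀ t x, ‖T t x‖ ≤ ‖x‖)
    (hc : ∀ v : Fin0, Tendsto (fun t => T t (incl v)) (𝓝 0) (𝓝 (incl v))) : IsC0Semigroup T := by
  refine ⟨h0, hadd, fun x => ?_⟩
  have hx : Tendsto (fun t => T t x - x) (𝓝 0) (𝓝 0) := by
    refine Metric.tendsto_nhds.2 fun ε hε => ?_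
    obtain ⟨v, hv⟩ := denseRange_incl.exists_dist_lt x (show 0 < ε / 3 by positivity)
    filter_upwards [Metric.tendsto_nhds.1 (hc v) (ε / 3) (by positivity)] with t ht
    have h1 : dist (T t x) (T t (incl v)) < ε / 3 := by
      rw [dist_eq_norm, ← map_sub]
      exact (hle _ _).trans_lt (by rwa [← dist_eq_norm])
    rw [dist_zero_right, ← dist_eq_norm]
    have h2 := dist_triangle4 (T t x) (T t (incl v)) (incl v) x
    rw [dist_comm (incl v) x] at h2
    linarith
  have hdist : ∀ s t, ‖T s x - T t x‖ ≤ ‖T (nndist s t) x - x‖ := by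
    have key : ∀ s t : ℝ≥0, s ≤ t → ‖T s x - T t x‖ ≤ ‖T (nndist s t) x - x‖ := by
      intro s t hst
      have hd : nndist s t = t - s := by
        rw [NNReal.nndist_eq, tsub_eq_zero_of_le hst, zero_max]
      have : t = s + nndist s t := by rw [hd, add_tsub_cancel_of_le hst]
      conv_lhs => rw [this, hadd, mul_apply_eq_comp, norm_sub_rev, ← map_sub]
      exact hle _ _
    intro s t
    rcases le_total s t with h | h
    · exact key s t h
    · rw [norm_sub_rev, nndist_comm]
      exact key t s h
  refine continuous_iff_continuousAt.2 fun t => tendsto_iff_norm_sub_tendsto_zero.2 ?_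
  have h1 : Tendsto (fun s => nndist s t) (𝓝 t) (𝓝 0) := by
    have : Continuous fun s => nndist s t := by fun_prop
    have h := this.tendsto t
    rwa [nndist_self] at h
  have h2 := (hx.comp h1).norm
  rw [norm_zero] at h2
  exact squeeze_zero (fun s => norm_nonneg _) (fun s => hdist s t) h2

/-- The tail from `n = 2` is dominated by a geometric series of ratio `1/2`. The quadratic error
identifies the generator of the limit semigroup. -/
theorem norm_exp_series_sub_le {C R t : ℝ} (hC : 0 ≤ C) (hR : 0 < R)
    {x : ℕ → Fock} (hx : ∀ n, ‖x n‖ ≤ C * n.factorial * R ^ n) (ht : 0 ≤ t) (hRt : R * t ≤ 1 / 2) :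
    ‖(∑' n : ℕ, ((n.factorial : ℂ)⁻¹ * (t : ℂ) ^ n) • x n) - x 0 - (t : ℂ) • x 1‖
      ≤ C * (R * t) ^ 2 * 2 := by
  have hterm : ∀ n : ℕ, ‖((n.factorial : ℂ)⁻¹ * (t : ℂ) ^ n) • x n‖ ≤ C * (R * t) ^ n := by
    intro n
    have hf : ((n.factorial : ℕ) : ℝ) ≠ 0 := by positivity
    rw [norm_smul, norm_mul, norm_inv, norm_pow, Complex.norm_natCast, Complex.norm_real,
      Real.norm_of_nonneg ht]
    calc ((n.factorial : ℝ))⁻¹ * t ^ n * ‖x n‖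
        ≤ ((n.factorial : ℝ))⁻¹ * t ^ n * (C * n.factorial * R ^ n) := by gcongr; exact hx n
      _ = C * (R * t) ^ n := by rw [mul_pow]; field_simp
  have hRt0 : 0 ≤ R * t := by positivity
  have hs : Summable fun n : ℕ => ((n.factorial : ℂ)⁻¹ * (t : ℂ) ^ n) • x n :=
    Summable.of_norm_bounded
      ((summable_geometric_of_lt_one hRt0 (by linarith)).mul_left C) hterm
  rw [← hs.sum_add_tsum_nat_add 2, Finset.sum_range_succ, Finset.sum_range_one]
  have e : ∀ a b c : Fock, a + b + c - a - b = c := fun a b c => by abel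
  simp only [Nat.factorial_zero, Nat.factorial_one, Nat.cast_one, inv_one, pow_zero, pow_one,
    one_mul, one_smul, e]
  refine tsum_of_norm_bounded (g := fun n => C * (R * t) ^ 2 * (1 / 2 : ℝ) ^ n)
    (hasSum_geometric_two.mul_left _) fun n => (hterm _).trans ?_
  rw [pow_add, mul_comm ((R * t) ^ n), ← mul_assoc]
  gcongr

/-- A dissipative operator of quadratic growth generates a contraction semigroup, the strong limit
of the exponentials of its truncations. -/
theorem QuadGrowth.exists_semigroup {G : Module.End ℂ Fin0} (hG : QuadGrowth G)
    (hd : Dissipative G) : ∃ T : ℝ≥0 → (Fock →L[ℂ] Fock), IsC0Semigroup T ∧ Generates G T ∧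
      ∀ (t : ℝ≥0) (x : Fock), Tendsto (fun N => NormedSpace.exp (((t : ℝ) : ℂ) • trunc G N) x) atTop
        (𝓝 (T t x)) := by
  have hlim := hG.exists_tendsto_exp_trunc hd
  choose L hL using hlim
  let T : ℝ≥0 → (Fock →L[ℂ] Fock) := fun t =>
    continuousLinearMapOfTendsto (fun N => NormedSpace.exp (((t : ℝ) : ℂ) • trunc G N))
      (tendsto_pi_nhds.2 (hL t))
  have hT : ∀ (t : ℝ≥0) (x : Fock), Tendsto (fun N => NormedSpace.exp (((t : ℝ) : ℂ) • trunc G N) x) atTop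
        (𝓝 (T t x)) := hL
  have hle : ∀ t x, ‖T t x‖ ≤ ‖x‖ := fun t x =>
    le_of_tendsto' (hT t x).norm fun N => hd.norm_exp_trunc_le N t.2 x
  have h0 : T 0 = 1 := by
    ext1 x
    refine tendsto_nhds_unique (hT 0 x) ?_
    simp
  have hadd : ∀ s t, T (s + t) = T s * T t := by
    intro s t
    ext1 x
    refine tendsto_nhds_unique (hT (s + t) x) ?_
    have := tendsto_apply_of_contraction (fun N x => hd.norm_exp_trunc_le N s.2 x) (hT t x)
      (hT s (T t x))
    refine this.congr fun N => ?_
    rw [← mul_apply_eq_comp, ← exp_add_smul]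
    push_cast; rfl
  obtain ⟨c, hc, hGc⟩ := hG
  set δ : ℝ := 1 / (2 * (4 * c + 1)) with hδ
  have hδ0 : 0 < δ := by positivity
  have hcδ : (4 * c + 1) * δ ≤ 1 / 2 := by
    rw [hδ]; field_simp; exact le_refl _
  -- This second-order estimate yields both strong continuity at zero and the value of the
  -- generator.
  have hest : ∀ v, ∃ K : ℝ, 0 ≤ K ∧ ∀ t : ℝ≥0, (t : ℝ) ≤ δ →
      ‖T t (incl v) - incl v - ((t : ℝ) : ℂ) • incl (G v)‖ ≤ K * (t : ℝ) ^ 2 := by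
    intro v
    obtain ⟨m, hm⟩ := exists_bound_support v
    refine ⟨2 ^ m * ‖incl v‖ * (4 * c + 1) ^ 2 * 2, by positivity, fun t ht => ?_⟩
    have e : T t (incl v) = _ := tendsto_nhds_unique (hT t (incl v))
      (hGc.tendsto_exp_trunc_incl hc (by linarith) t.2 ht v)
    rw [e]
    have h := norm_exp_series_sub_le (C := 2 ^ m * ‖incl v‖) (R := 4 * c + 1) (t := t)
      (x := fun n => incl ((G ^ n) v)) (by positivity) (by positivity) (fun n => by
        refine (hGc.iterate_le hc m v hm n).trans ?_
        gcongr; linarith) t.2 ((mul_le_mul_of_nonneg_left ht (by positivity)).trans hcδ)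
    simp only [pow_zero, pow_one, Module.End.one_apply] at h
    refine h.trans (le_of_eq ?_)
    ring
  have hsmall : ∀ᶠ t : ℝ≥0 in 𝓝 0, (t : ℝ) ≤ δ := by
    have h : Tendsto (fun t : ℝ≥0 => (t : ℝ)) (𝓝 0) (𝓝 0) := by
      have : Continuous fun t : ℝ≥0 => (t : ℝ) := by fun_prop
      simpa using this.tendsto 0
    exact (h.eventually (gt_mem_nhds hδ0)).mono fun t ht => ht.le
  have hcoe : Tendsto (fun t : ℝ≥0 => (t : ℝ)) (𝓝 0) (𝓝 0) := by
    have : Continuous fun t : ℝ≥0 => (t : ℝ) := by fun_prop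
    simpa using this.tendsto 0
  refine ⟨T, isC0Semigroup_of_contraction h0 hadd hle fun v => ?_, fun v => ?_, hT⟩
  · obtain ⟨K, hK, h⟩ := hest v
    refine tendsto_iff_norm_sub_tendsto_zero.2 (squeeze_zero'
      (g := fun t : ℝ≥0 => K * (t : ℝ) ^ 2 + (t : ℝ) * ‖incl (G v)‖)
      (Eventually.of_forall fun _ => norm_nonneg _) ?_ ?_)
    · filter_upwards [hsmall] with t ht
      calc ‖T t (incl v) - incl v‖
          = ‖(T t (incl v) - incl v - ((t : ℝ) : ℂ) • incl (G v)) +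
              ((t : ℝ) : ℂ) • incl (G v)‖ := by rw [sub_add_cancel]
        _ ≤ _ := norm_add_le _ _
        _ ≤ K * (t : ℝ) ^ 2 + (t : ℝ) * ‖incl (G v)‖ := by
          refine add_le_add (h t ht) ?_
          rw [norm_smul, Complex.norm_real, Real.norm_of_nonneg (NNReal.coe_nonneg t)]
    · simpa using ((hcoe.pow 2).const_mul K).add (hcoe.mul_const ‖incl (G v)‖)
  · obtain ⟨K, hK, h⟩ := hest v
    refine tendsto_iff_norm_sub_tendsto_zero.2 (squeeze_zero'
      (g := fun t : ℝ≥0 => K * (t : ℝ))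
      (Eventually.of_forall fun _ => norm_nonneg _) ?_ ?_)
    · filter_upwards [nhdsWithin_le_nhds hsmall, self_mem_nhdsWithin] with t ht ht0
      have ht0 : (0 : ℝ) < t := ht0
      have hne : ((t : ℝ) : ℂ) ≠ 0 := by exact_mod_cast ht0.ne'
      have e : ((t : ℝ) : ℂ)⁻¹ • (T t (incl v) - incl v) - incl (G v) =
          ((t : ℝ) : ℂ)⁻¹ • (T t (incl v) - incl v - ((t : ℝ) : ℂ) • incl (G v)) := by
        rw [smul_sub _ (T t (incl v) - incl v), smul_smul, inv_mul_cancel₀ hne, one_smul]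
      rw [e, norm_smul, norm_inv, Complex.norm_real, Real.norm_of_nonneg ht0.le,
        inv_mul_le_iff₀ ht0]
      exact (h t ht).trans (le_of_eq (by ring))
    · have := (hcoe.mono_left (nhdsWithin_le_nhds (s := Set.Ioi (0 : ℝ≥0)))).const_mul K
      simpa using this

theorem isExp_iff_opExp {G : Module.End ℂ Fin0} (hG : QuadGrowth G) (hd : Dissipative G)
    (E : Fock →L[ℂ] Fock) : IsExp G E ↔ E = opExp G := by
  obtain ⟨T, hT, hTG, -⟩ := hG.exists_semigroup hd
  rw [isExp_iff_of_semigroup hG hT hTG, opExp_eq_of_semigroup hG hT hTG]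

/-! ### Unitary semigroups of antisymmetric generators -/

theorem dissipative_of_isAdj_neg {G : Module.End ℂ Fin0} (h : IsAdj G (-G)) : Dissipative G := by
  intro v
  have h1 := h v v
  rw [LinearMap.neg_apply, map_neg, inner_neg_right, ← inner_conj_symm] at h1
  have h2 := congrArg Complex.re h1
  rw [Complex.conj_re, Complex.neg_re] at h2
  linarith

theorem adjoint_trunc {G : Module.End ℂ Fin0} (h : IsAdj G (-G)) (N : ℕ) :
    ContinuousLinearMap.adjoint (trunc G N) = -trunc G N := by
  symm
  rw [ContinuousLinearMap.eq_adjoint_iff]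
  intro x y
  rw [neg_apply, inner_neg_left, ← inner_conj_symm, inner_trunc, inner_conj_symm, h,
    inner_trunc, LinearMap.neg_apply, map_neg, inner_neg_right, neg_neg]

theorem trunc_neg (G : Module.End ℂ Fin0) (N : ℕ) : trunc (-G) N = -trunc G N := by
  ext1 x
  rw [neg_apply, trunc_apply, trunc_apply]
  simp

theorem isAdj_neg_neg {G : Module.End ℂ Fin0} (h : IsAdj G (-G)) : IsAdj (-G) (- -G) := by
  have e : - -G = G := by ext; simp
  rw [e]
  exact h.symm

/-- An antisymmetric operator of quadratic growth generates a semigroup of unitary operators. -/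
theorem exists_unitary_semigroup {G : Module.End ℂ Fin0} (hG : QuadGrowth G)
    (h : IsAdj G (-G)) : ∃ U : ℝ≥0 → (Fock →L[ℂ] Fock), IsC0Semigroup U ∧ Generates G U ∧
      (∀ t, ContinuousLinearMap.adjoint (U t) * U t = 1) ∧
      ∀ t, U t * ContinuousLinearMap.adjoint (U t) = 1 := by
  have hd := dissipative_of_isAdj_neg h
  have hd' := dissipative_of_isAdj_neg (isAdj_neg_neg h)
  obtain ⟨U, hU, hUG, hUl⟩ := hG.exists_semigroup hd
  obtain ⟨V, hV, hVG, hVl⟩ := hG.neg.exists_semigroup hd'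
  -- The truncations are anti-self-adjoint, so the exponentials for `-G` and `G` are adjoint at
  -- every `N`, and this identity passes to the limit inside the inner product.
  have hadj : ∀ t, V t = ContinuousLinearMap.adjoint (U t) := by
    intro t
    rw [ContinuousLinearMap.eq_adjoint_iff]
    intro x y
    refine tendsto_nhds_unique ((hVl t x).inner tendsto_const_nhds)
      (((tendsto_const_nhds (x := x)).inner (hUl t y)).congr fun N => ?_)
    have e : NormedSpace.exp (((t : ℝ) : ℂ) • trunc (-G) N) =
        ContinuousLinearMap.adjoint (NormedSpace.exp (((t : ℝ) : ℂ) • trunc G N)) := by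
      rw [← ContinuousLinearMap.star_eq_adjoint, NormedSpace.star_exp, star_smul,
        ContinuousLinearMap.star_eq_adjoint, adjoint_trunc h, trunc_neg]
      congr 2
      exact (Complex.conj_ofReal _).symm
    rw [e, ContinuousLinearMap.adjoint_inner_left]
  -- At every `N` the exponentials of `F` and `-F` are inverse to each other; contractivity allows
  -- the limit in both factors at once. Using it for `G` and for `-G` gives the two unitarity
  -- relations.
  have key : ∀ {F : Module.End ℂ Fin0} {A B : ℝ≥0 → (Fock →L[ℂ] Fock)}, Dissipative F →
      (∀ (t : ℝ≥0) (x : Fock), Tendsto (fun N => NormedSpace.exp (((t : ℝ) : ℂ) • trunc F N) x) atTop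
        (𝓝 (A t x))) →
      (∀ (t : ℝ≥0) (x : Fock), Tendsto (fun N => NormedSpace.exp (((t : ℝ) : ℂ) • trunc (-F) N) x) atTop
        (𝓝 (B t x))) → ∀ t, A t * B t = 1 := by
    intro F A B hF hA hB t
    ext1 x
    refine tendsto_nhds_unique (tendsto_apply_of_contraction
      (fun N x => hF.norm_exp_trunc_le N t.2 x) (hB t x) (hA t (B t x))) ?_
    refine tendsto_const_nhds.congr fun N => ?_
    rw [trunc_neg, smul_neg, ← neg_smul, NNReal.val_eq_coe, ← mul_apply_eq_comp, ← exp_add_smul]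
    simp
  refine ⟨U, hU, hUG, fun t => ?_, fun t => ?_⟩
  · rw [← hadj]
    refine key hd' hVl ?_ t
    have e : - -G = G := by ext; simp
    rw [e]; exact hUl
  · rw [← hadj]
    exact key hd hUl hVl t

/-! ### Nuclear operators, traces and expectations -/

/-- The operator `∑ₙ |xₙ⟩⟨yₙ|`. -/
noncomputable def nuclear (x y : ℕ → Fock) : Fock →L[ℂ] Fock :=
  ∑' n, InnerProductSpace.rankOne ℂ (x n) (y n)

section Nuclear

variable {x y : ℕ → Fock}

theorem nuclear_hasSum (hs : Summable fun n => ‖x n‖ * ‖y n‖) :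
    HasSum (fun n => InnerProductSpace.rankOne ℂ (x n) (y n)) (nuclear x y) :=
  (Summable.of_norm (by simpa using hs)).hasSum

theorem nuclear_apply_hasSum (hs : Summable fun n => ‖x n‖ * ‖y n‖) (z : Fock) :
    HasSum (fun n => inner ℂ (y n) z • x n) (nuclear x y z) := by
  have h := (ContinuousLinearMap.apply ℂ Fock z).hasSum (nuclear_hasSum hs)
  refine h.congr_fun fun n => ?_
  simp

theorem inner_nuclear_hasSum (hs : Summable fun n => ‖x n‖ * ‖y n‖) (w z : Fock) :
    HasSum (fun n => inner ℂ (y n) z * inner ℂ w (x n)) (inner ℂ w (nuclear x y z)) := by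
  have h := (innerSL ℂ w).hasSum (nuclear_apply_hasSum hs z)
  refine h.congr_fun fun n => ?_
  simp

theorem summable_norm_conj (hs : Summable fun n => ‖x n‖ * ‖y n‖) (A B : Fock →L[ℂ] Fock) :
    Summable fun n => ‖A (x n)‖ * ‖B (y n)‖ := by
  refine Summable.of_nonneg_of_le (fun n => by positivity) (fun n => ?_)
    (hs.mul_left (‖A‖ * ‖B‖))
  calc ‖A (x n)‖ * ‖B (y n)‖ ≤ (‖A‖ * ‖x n‖) * (‖B‖ * ‖y n‖) := by
        gcongr <;> exact ContinuousLinearMap.le_opNorm _ _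
    _ = _ := by ring

theorem conj_nuclear (hs : Summable fun n => ‖x n‖ * ‖y n‖) (A B : Fock →L[ℂ] Fock) :
    A * nuclear x y * ContinuousLinearMap.adjoint B
      = nuclear (fun n => A (x n)) (fun n => B (y n)) := by
  ext1 z
  have h1 := A.hasSum (nuclear_apply_hasSum hs (ContinuousLinearMap.adjoint B z))
  have h2 := nuclear_apply_hasSum (summable_norm_conj hs A B) z
  rw [mul_apply_eq_comp, mul_apply_eq_comp]
  refine h1.unique (h2.congr_fun fun n => ?_)
  simp [ContinuousLinearMap.adjoint_inner_right]

theorem sum_norm_inner_mul_inner_le (e : HilbertBasis ℕ ℂ Fock) (x y : Fock) (s : Finset ℕ) :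
    ∑ k ∈ s, ‖inner ℂ y (e k) * inner ℂ (e k) x‖ ≤ ‖x‖ * ‖y‖ := by
  have h1 := e.orthonormal.sum_inner_products_le x (s := s)
  have h2 := e.orthonormal.sum_inner_products_le y (s := s)
  have h3 := Real.sum_mul_le_sqrt_mul_sqrt s (fun k => ‖inner ℂ (e k) y‖)
    (fun k => ‖inner ℂ (e k) x‖)
  calc ∑ k ∈ s, ‖inner ℂ y (e k) * inner ℂ (e k) x‖
      = ∑ k ∈ s, ‖inner ℂ (e k) y‖ * ‖inner ℂ (e k) x‖ := by
        refine Finset.sum_congr rfl fun k _ => ?_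
        rw [norm_mul, norm_inner_symm]
    _ ≤ √(∑ k ∈ s, ‖inner ℂ (e k) y‖ ^ 2) * √(∑ k ∈ s, ‖inner ℂ (e k) x‖ ^ 2) := h3
    _ ≤ ‖y‖ * ‖x‖ := by
        gcongr
        · exact Real.sqrt_le_iff.2 ⟨norm_nonneg _, h2⟩
        · exact Real.sqrt_le_iff.2 ⟨norm_nonneg _, h1⟩
    _ = _ := mul_comm _ _

/-- Expanding each `⟨y n, x n⟩` in the basis `e` gives a double series, absolutely summable by
Cauchy–Schwarz and Bessel. Summing it in the other order gives the diagonal of the operator in `e`.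
-/
theorem hasTrace_nuclear (hs : Summable fun n => ‖x n‖ * ‖y n‖) {τ : ℂ}
    (hτ : HasSum (fun n => inner ℂ (y n) (x n)) τ) : HasTrace (nuclear x y) τ := by
  intro e
  let f : ℕ × ℕ → ℂ := fun p => inner ℂ (y p.1) (e p.2) * inner ℂ (e p.2) (x p.1)
  have hrow : ∀ n, HasSum (fun k => f (n, k)) (inner ℂ (y n) (x n)) := fun n =>
    e.hasSum_inner_mul_inner (y n) (x n)
  have hle : ∀ n (s : Finset ℕ), ∑ k ∈ s, ‖f (n, k)‖ ≤ ‖x n‖ * ‖y n‖ := fun n s =>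
    sum_norm_inner_mul_inner_le e (x n) (y n) s
  have hnrow : ∀ n, Summable fun k => ‖f (n, k)‖ := fun n =>
    summable_of_sum_le (f := fun k => ‖f (n, k)‖) (c := ‖x n‖ * ‖y n‖)
      (fun k => norm_nonneg (f (n, k))) (hle n)
  have hsum : Summable f := by
    refine Summable.of_norm ((summable_prod_of_nonneg fun _ => norm_nonneg _).2 ⟨hnrow, ?_⟩)
    exact Summable.of_nonneg_of_le (fun n => tsum_nonneg fun _ => norm_nonneg _)
      (fun n => (hnrow n).tsum_le_of_sum_le (hle n)) hs
  have htot : HasSum f τ := by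
    have h := hsum.hasSum
    rwa [(h.prod_fiberwise hrow).unique hτ] at h
  have hswap : HasSum (f ∘ Prod.swap) τ := (Equiv.prodComm ℕ ℕ).hasSum_iff.2 htot
  exact hswap.prod_fiberwise fun k => inner_nuclear_hasSum hs (e k) (e k)

end Nuclear

/-- The number states as a Hilbert basis. -/
noncomputable def ketBasis : HilbertBasis ℕ ℂ Fock :=
  HilbertBasis.ofRepr (LinearIsometryEquiv.refl ℂ _)

theorem ketBasis_apply (n : ℕ) : ketBasis n = ket n := by
  rw [← HilbertBasis.repr_symm_single]; rfl

theorem HasTrace.unique {T : Fock →L[ℂ] Fock} {τ σ : ℂ} (h : HasTrace T τ) (h' : HasTrace T σ) :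
    τ = σ := (h ketBasis).unique (h' ketBasis)

theorem HasTrace.opTrace_eq {T : Fock →L[ℂ] Fock} {τ : ℂ} (h : HasTrace T τ) : opTrace T = τ := by
  have := (h ketBasis).tsum_eq
  simp only [ketBasis_apply] at this
  exact this

theorem HasTrace.smul {T : Fock →L[ℂ] Fock} {τ : ℂ} (h : HasTrace T τ) (z : ℂ) :
    HasTrace (z • T) (z * τ) := fun e => by
  simpa only [smul_apply, inner_smul_right] using (h e).mul_left z

/-- A bounded extension from a dense subspace is unique, so the expectation is well defined. -/
theorem HasExpectation.unique {ρ : Fock →L[ℂ] Fock} {A : Module.End ℂ Fin0} {μ ν : ℂ}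
    (h : HasExpectation ρ A μ) (h' : HasExpectation ρ A ν) : μ = ν := by
  obtain ⟨T, hT, hμ⟩ := h
  obtain ⟨S, hS, hν⟩ := h'
  have : T = S := clm_ext_incl fun v => by rw [hT, hS]
  rw [this] at hμ
  exact hμ.unique hν

/-! ### Heisenberg picture and eigenvectors -/

theorem factorial_bound_mono {C R R' x : ℝ} {n : ℕ} (hx : x ≤ C * n.factorial * R ^ n)
    (hC : 0 ≤ C) (hR : 0 ≤ R) (h : R ≤ R') : x ≤ C * n.factorial * R' ^ n :=
  hx.trans (by gcongr)

/-- The Heisenberg picture: if the combinations `C t = ∑ i, h i t • D i` of operators of quadratic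
growth satisfy `C' = - [G, C]` and `C 0` has formal adjoint `A`, then `exp (t G) (C t)` has adjoint
`A exp (t G)†` in the weak sense. -/
theorem inner_semigroup_heisenberg {ι : Type*} [Fintype ι] {G : Module.End ℂ Fin0}
    (hG : QuadGrowth G) {T : ℝ≥0 → (Fock →L[ℂ] Fock)} (hT : IsC0Semigroup T)
    (hTG : Generates G T) {D : ι → Module.End ℂ Fin0} (hD : ∀ i, QuadGrowth (D i))
    {h h' : ι → ℝ → ℂ} (hh : ∀ i t, HasDerivAt (h i) (h' i t) t)
    (hcomm : ∀ t, ∑ i, h' i t • D i + G * ∑ i, h i t • D i = (∑ i, h i t • D i) * G)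
    {A : Module.End ℂ Fin0} (hA : IsAdj (∑ i, h i 0 • D i) A) (t : ℝ≥0) (w v : Fin0) :
    inner ℂ (T t (incl ((∑ i, h i t • D i) w))) (incl v) =
      inner ℂ (T t (incl w)) (incl (A v)) := by
  have hexp : ∀ s : ℝ, ∀ S : Fock →L[ℂ] Fock, ∀ x, S (incl ((∑ i, h i s • D i) x))
      = ∑ i, h i s • S (incl (D i x)) := fun s S x => by
    simp [LinearMap.sum_apply, map_sum]
  obtain ⟨M, hM0, hM⟩ := hT.exists_bound t
  obtain ⟨R₀, hR₀, hB⟩ := hG.analytic quadGrowth_one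
  obtain ⟨C₀, hC₀, hC⟩ := hB w
  choose R hR hDR using fun i => hG.analytic (hD i)
  choose C hC0 hCD using fun i => hDR i w
  choose b hb using fun i => (isCompact_Icc (a := (0 : ℝ)) (b := t)).exists_bound_of_continuousOn
    (f := h i) (fun s _ => (hh i s).continuousAt.continuousWithinAt)
  have hb0 : ∀ i, 0 ≤ b i := fun i => (norm_nonneg _).trans (hb i 0 ⟨le_rfl, t.2⟩)
  -- One rate dominating those of all the operators `D i`, so that a single factorial bound serves
  -- the whole combination.
  set R' : ℝ := R₀ + ∑ i, R i with hR'
  have hsum0 : 0 ≤ ∑ i, R i := Finset.sum_nonneg fun i _ => (hR i).le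
  have hRi : ∀ i, R i ≤ R' := fun i => by
    have := Finset.single_le_sum (f := R) (fun i _ => (hR i).le) (Finset.mem_univ i)
    linarith
  -- With `w` replaced by `G ^ n w`, the difference of the two sides is `φ n`. Its derivative is `φ
  -- (n + 1)`, because the commutation hypothesis turns `C' + G C` into `C G`.
  have key := eq_zero_of_iterated_deriv
    (φ := fun n s => inner ℂ (∑ i, h i s • T s.toNNReal (incl (D i ((G ^ n) w)))) (incl v) -
      inner ℂ (T s.toNNReal (incl ((G ^ n) w))) (incl (A v)))
    (T := t) (C := (∑ i, b i * (M * C i)) * ‖incl v‖ + M * C₀ * ‖incl (A v)‖) (R := R')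
    (by
      have : 0 ≤ ∑ i, b i * (M * C i) := Finset.sum_nonneg fun i _ =>
        mul_nonneg (hb0 i) (mul_nonneg hM0 (hC0 i))
      positivity)
    (by positivity) ?_ ?_ ?_ ?_ 0 t ⟨t.2, le_rfl⟩
  · rw [hexp]
    simpa [sub_eq_zero] using key
  · intro n
    refine Continuous.continuousOn (Continuous.sub (Continuous.inner ?_ continuous_const)
      (Continuous.inner (hT.continuous_toNNReal _) continuous_const))
    exact continuous_finsetSum _ fun i _ =>
      (continuous_iff_continuousAt.2 fun s => (hh i s).continuousAt).smul
        (hT.continuous_toNNReal _)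
  · intro n s hs
    have h1 : HasDerivWithinAt (fun s : ℝ => ∑ i, h i s • T s.toNNReal (incl (D i ((G ^ n) w))))
        (∑ i, (h i s • T s.toNNReal (incl (G (D i ((G ^ n) w)))) +
          h' i s • T s.toNNReal (incl (D i ((G ^ n) w))))) (Set.Ici s) s :=
      HasDerivWithinAt.fun_sum fun i _ =>
        ((hh i s).hasDerivWithinAt).smul (hT.hasDerivWithinAt hTG _ s hs.1)
    have h2 : ∑ i, (h i s • T s.toNNReal (incl (G (D i ((G ^ n) w)))) +
          h' i s • T s.toNNReal (incl (D i ((G ^ n) w))))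
        = ∑ i, h i s • T s.toNNReal (incl (D i ((G ^ (n + 1)) w))) := by
      have e := congrArg (fun F : Module.End ℂ Fin0 => T s.toNNReal (incl (F ((G ^ n) w)))) (hcomm s)
      simp only [LinearMap.add_apply, Module.End.mul_apply, map_add, LinearMap.sum_apply,
        LinearMap.smul_apply, map_sum, map_smul] at e
      rw [Finset.sum_add_distrib, add_comm, e, pow_succ']
      rfl
    rw [h2] at h1
    have h3 := h1.inner ℂ (hasDerivWithinAt_const s (Set.Ici s) (incl v))
    have h4 := (hT.hasDerivWithinAt hTG ((G ^ n) w) s hs.1).inner ℂ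
      (hasDerivWithinAt_const s (Set.Ici s) (incl (A v)))
    rw [inner_zero_right, zero_add] at h3 h4
    rw [← Module.End.mul_apply, ← pow_succ'] at h4
    exact h3.sub h4
  · intro n
    have e := hexp 0 1 ((G ^ n) w)
    simp only [Real.toNNReal_zero, hT.zero] at e ⊢
    rw [← e, one_apply_eq_self, one_apply_eq_self, hA, sub_self]
  · intro n s hs
    have hs' : s.toNNReal ≤ t := Real.toNNReal_le_iff_le_coe.2 hs.2
    have hbd : ∀ {x : Fock} {K : ℝ}, ‖x‖ ≤ K → ‖T s.toNNReal x‖ ≤ M * K := fun hx =>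
      (T _).le_of_opNorm_le_of_le (hM _ hs') hx
    have h1 : ‖∑ i, h i s • T s.toNNReal (incl (D i ((G ^ n) w)))‖ ≤
        (∑ i, b i * (M * C i)) * n.factorial * R' ^ n := by
      rw [Finset.sum_mul, Finset.sum_mul]
      refine (norm_sum_le _ _).trans (Finset.sum_le_sum fun i _ => ?_)
      rw [norm_smul]
      calc ‖h i s‖ * ‖T s.toNNReal (incl (D i ((G ^ n) w)))‖
          ≤ b i * (M * (C i * n.factorial * R' ^ n)) := by
            refine mul_le_mul (hb i s hs) (hbd ?_) (norm_nonneg _) (hb0 i)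
            exact factorial_bound_mono (hCD i n) (hC0 i) (hR i).le (hRi i)
        _ = _ := by ring
    have h2 : ‖T s.toNNReal (incl ((G ^ n) w))‖ ≤ M * (C₀ * n.factorial * R' ^ n) :=
      hbd (factorial_bound_mono (hC n) hC₀ hR₀.le (by linarith))
    calc _ ≤ ‖∑ i, h i s • T s.toNNReal (incl (D i ((G ^ n) w)))‖ * ‖incl v‖ +
          ‖T s.toNNReal (incl ((G ^ n) w))‖ * ‖incl (A v)‖ :=
          (norm_sub_le _ _).trans (add_le_add (norm_inner_le_norm _ _) (norm_inner_le_norm _ _))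
      _ ≤ ((∑ i, b i * (M * C i)) * n.factorial * R' ^ n) * ‖incl v‖ +
          (M * (C₀ * n.factorial * R' ^ n)) * ‖incl (A v)‖ := by gcongr
      _ = _ := by ring

/-- Eigenvectors of the generator are eigenvectors of the semigroup. -/
theorem IsC0Semigroup.apply_eigenvector {G : Module.End ℂ Fin0}
    {T : ℝ≥0 → (Fock →L[ℂ] Fock)} (hT : IsC0Semigroup T) (hTG : Generates G T) {v : Fin0} {z : ℂ}
    (hv : G v = z • v) (t : ℝ≥0) : T t (incl v) = Complex.exp (z * (t : ℝ)) • incl v := by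
  let f : ℝ → Fock := fun s => T s.toNNReal (incl v) - Complex.exp (z * s) • incl v
  have hcont : Continuous f := (hT.continuous_toNNReal _).sub (by fun_prop)
  have hder : ∀ s, 0 ≤ s → HasDerivWithinAt f (z • f s) (Set.Ici s) s := by
    intro s hs
    have h1 := hT.hasDerivWithinAt hTG v s hs
    have h2 : HasDerivAt (fun s : ℝ => Complex.exp (z * s)) (Complex.exp (z * s) * z) s := by
      have := ((hasDerivAt_id (s : ℂ)).const_mul z).cexp.comp_ofReal
      simpa using this
    have h3 := h1.sub (h2.smul_const (incl v)).hasDerivWithinAt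
    refine h3.congr_deriv ?_
    simp only [f, hv, map_smul, smul_sub, smul_smul, mul_comm z]
  obtain ⟨b, hb⟩ := (isCompact_Icc (a := (0 : ℝ)) (b := t)).exists_bound_of_continuousOn
    hcont.continuousOn
  have hb0 : 0 ≤ b := (norm_nonneg _).trans (hb 0 ⟨le_rfl, t.2⟩)
  -- The difference `f` solves `f' = z f` with `f 0 = 0`, so its successive derivatives are `z ^ n •
  -- f`.
  have key := eq_zero_of_iterated_deriv (φ := fun n s => z ^ n • f s) (T := t) (C := b)
    (R := ‖z‖ + 1) hb0 (by positivity) (fun n => (hcont.const_smul (z ^ n)).continuousOn)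
    (fun n s hs => by
      rw [pow_succ, mul_smul]
      exact (hder s hs.1).const_smul (z ^ n))
    (fun n => by simp [f, hT.zero])
    (fun n s hs => by
      rw [norm_smul, norm_pow]
      have h1 : (1 : ℝ) ≤ n.factorial := by exact_mod_cast Nat.one_le_iff_ne_zero.2 n.factorial_ne_zero
      calc ‖z‖ ^ n * ‖f s‖ ≤ (‖z‖ + 1) ^ n * b := by
            gcongr
            · linarith
            · exact hb s hs
        _ = b * 1 * (‖z‖ + 1) ^ n := by ring
        _ ≤ _ := by gcongr)
    0 t ⟨t.2, le_rfl⟩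
  simpa [f, sub_eq_zero] using key

/-! ### Thermal weights and the diagonal operators -/

/-- The Boltzmann weight of the number state `|n⟩`. -/
noncomputable def weight (ϑ : ℝ) (n : ℕ) : ℝ := Real.exp (-(ϑ * (n + 1 / 2)))

theorem weight_pos (ϑ : ℝ) (n : ℕ) : 0 < weight ϑ n := Real.exp_pos _

theorem weight_eq (ϑ : ℝ) (n : ℕ) :
    weight ϑ n = Real.exp (-(ϑ / 2)) * Real.exp (-ϑ) ^ n := by
  rw [weight, ← Real.exp_nat_mul, ← Real.exp_add]
  congr 1; ring

/-- The value `1 / (2 sinh (ϑ/2))` of the partition function. -/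
noncomputable def zReal (ϑ : ℝ) : ℝ := 1 / 2 * (Real.sinh (ϑ / 2))⁻¹

/-- The mean excitation `½ coth (ϑ/2)` of the thermal state. -/
noncomputable def halfCoth (ϑ : ℝ) : ℝ := Real.cosh (ϑ / 2) / (2 * Real.sinh (ϑ / 2))

theorem exp_neg_eq_half_mul (ϑ : ℝ) :
    Real.exp (-ϑ) = Real.exp (-(ϑ / 2)) * Real.exp (-(ϑ / 2)) := by
  rw [← Real.exp_add]; congr 1; ring

theorem one_sub_exp_neg (ϑ : ℝ) :
    1 - Real.exp (-ϑ) = 2 * Real.sinh (ϑ / 2) * Real.exp (-(ϑ / 2)) := by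
  have e1 : Real.exp (ϑ / 2) * Real.exp (-(ϑ / 2)) = 1 := by
    rw [← Real.exp_add]; simp
  rw [Real.sinh_eq, exp_neg_eq_half_mul]
  linear_combination -e1

section Weight

variable {ϑ : ℝ} (hϑ : 0 < ϑ)
include hϑ

theorem sinh_half_pos : 0 < Real.sinh (ϑ / 2) := Real.sinh_pos_iff.2 (by positivity)

theorem zReal_pos : 0 < zReal ϑ := by
  have := sinh_half_pos hϑ
  unfold zReal; positivity

theorem halfCoth_pos : 0 < halfCoth ϑ := by
  have := sinh_half_pos hϑ
  have := Real.cosh_pos (ϑ / 2)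
  unfold halfCoth; positivity

theorem halfCoth_sq : halfCoth ϑ ^ 2 - 1 / 4 = zReal ϑ ^ 2 := by
  have h := (sinh_half_pos hϑ).ne'
  have h2 := Real.cosh_sq (ϑ / 2)
  unfold halfCoth zReal
  field_simp
  rw [h2]; ring

theorem exp_neg_half_eq : Real.exp (-(ϑ / 2)) = zReal ϑ * (1 - Real.exp (-ϑ)) := by
  have h := (sinh_half_pos hϑ).ne'
  rw [one_sub_exp_neg, zReal]; field_simp

theorem hasSum_weight : HasSum (weight ϑ) (zReal ϑ) := by
  have hq : Real.exp (-ϑ) < 1 := by simpa using hϑ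
  have h := (hasSum_geometric_of_lt_one (Real.exp_pos (-ϑ)).le hq).mul_left (Real.exp (-(ϑ / 2)))
  have h1 : 1 - Real.exp (-ϑ) ≠ 0 := by linarith
  rw [exp_neg_half_eq hϑ, mul_assoc, mul_inv_cancel₀ h1, mul_one, ← exp_neg_half_eq hϑ] at h
  exact h.congr_fun (weight_eq ϑ)

theorem hasSum_weight_mul : HasSum (fun n => weight ϑ n * n) (zReal ϑ * (halfCoth ϑ - 1 / 2)) := by
  have hq : Real.exp (-ϑ) < 1 := by simpa using hϑ
  have h := (hasSum_coe_mul_geometric_of_norm_lt_one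
    (r := Real.exp (-ϑ)) (by rwa [Real.norm_of_nonneg (Real.exp_pos _).le])).mul_left
    (Real.exp (-(ϑ / 2)))
  have h1 : 1 - Real.exp (-ϑ) ≠ 0 := by linarith
  have hs := (sinh_half_pos hϑ).ne'
  have e : Real.exp (-(ϑ / 2)) * (Real.exp (-ϑ) / (1 - Real.exp (-ϑ)) ^ 2)
      = zReal ϑ * (halfCoth ϑ - 1 / 2) := by
    rw [exp_neg_half_eq hϑ]
    -- The mean occupation number `q / (1 - q)` for `q = exp (-ϑ)`; the identity `exp (-ϑ/2) = cosh
    -- (ϑ/2) - sinh (ϑ/2)` turns it into `½ coth (ϑ/2) - 1/2`.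
    have : Real.exp (-ϑ) / (1 - Real.exp (-ϑ)) = halfCoth ϑ - 1 / 2 := by
      have e3 := (Real.exp_pos (-(ϑ / 2))).ne'
      have e4 : Real.exp (-(ϑ / 2)) = Real.cosh (ϑ / 2) - Real.sinh (ϑ / 2) := by
        rw [Real.cosh_sub_sinh]
      rw [one_sub_exp_neg, exp_neg_eq_half_mul, halfCoth, mul_div_mul_right _ _ e3, e4]
      field_simp
    rw [← this]
    field_simp
  rw [e] at h
  refine h.congr_fun fun n => ?_
  rw [weight_eq]; ring

end Weight

theorem norm_weight_smul_ket (ϑ : ℝ) (n : ℕ) : ‖(weight ϑ n : ℂ) • ket n‖ = weight ϑ n := by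
  rw [norm_smul, norm_ket, mul_one, Complex.norm_real, Real.norm_of_nonneg (weight_pos ϑ n).le]

theorem summable_weight_ket {ϑ : ℝ} (hϑ : 0 < ϑ) :
    Summable fun n => ‖(weight ϑ n : ℂ) • ket n‖ * ‖ket n‖ := by
  simpa only [norm_weight_smul_ket, norm_ket, mul_one] using (hasSum_weight hϑ).summable

theorem numHalf_smul_single (z : ℂ) (n : ℕ) :
    (z • numHalf) (Finsupp.single n 1) = (z * ((n : ℂ) + 1 / 2)) • Finsupp.single n 1 := by
  rw [LinearMap.smul_apply, numHalf_single, smul_smul]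

theorem dissipative_thermalGen {ϑ : ℝ} (hϑ : 0 < ϑ) : Dissipative (thermalGen ϑ) := by
  intro v
  obtain ⟨m, hm⟩ := exists_bound_support v
  rw [inner_incl_incl _ _ m hm, Complex.re_sum]
  refine Finset.sum_nonpos fun n _ => ?_
  have e : (starRingEnd ℂ) (v n) * thermalGen ϑ v n
      = ((-(ϑ * (n + 1 / 2) * Complex.normSq (v n)) : ℝ) : ℂ) := by
    rw [thermalGen, LinearMap.smul_apply, Finsupp.smul_apply, numHalf_apply, smul_eq_mul]
    push_cast
    rw [Complex.normSq_eq_conj_mul_self]; ring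
  rw [e, Complex.ofReal_re, neg_nonpos]
  have := Complex.normSq_nonneg (v n)
  positivity

theorem quadGrowth_thermalGen (ϑ : ℝ) : QuadGrowth (thermalGen ϑ) := quadGrowth_numHalf.smul _

theorem quadGrowth_rotationGen (θ : ℝ) : QuadGrowth (rotationGen θ) := quadGrowth_numHalf.smul _

theorem boltzmann_ket {ϑ : ℝ} (hϑ : 0 < ϑ) (n : ℕ) :
    boltzmann ϑ (ket n) = (weight ϑ n : ℂ) • ket n := by
  obtain ⟨T, hT, hTG, -⟩ := (quadGrowth_thermalGen ϑ).exists_semigroup (dissipative_thermalGen hϑ)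
  rw [boltzmann, opExp_eq_of_semigroup (quadGrowth_thermalGen ϑ) hT hTG, ← incl_single_one,
    hT.apply_eigenvector hTG (numHalf_smul_single _ n), weight]
  congr 1
  push_cast
  congr 1; ring

theorem rotation_ket (θ : ℝ) (n : ℕ) :
    rotation θ (ket n) = Complex.exp (((-(θ * (n + 1 / 2)) : ℝ) : ℂ) * Complex.I) • ket n := by
  obtain ⟨T, hT, hTG, -⟩ := (quadGrowth_rotationGen θ).exists_semigroup
    (dissipative_of_isAdj_neg (isAdj_rotationGen θ))
  rw [rotation, opExp_eq_of_semigroup (quadGrowth_rotationGen θ) hT hTG, ← incl_single_one,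
    hT.apply_eigenvector hTG (numHalf_smul_single _ n)]
  congr 2
  push_cast; ring

theorem boltzmann_eq_nuclear {ϑ : ℝ} (hϑ : 0 < ϑ) :
    boltzmann ϑ = nuclear (fun n => (weight ϑ n : ℂ) • ket n) ket := by
  refine clm_ext_ket fun k => ?_
  rw [boltzmann_ket hϑ]
  refine HasSum.unique ?_ (nuclear_apply_hasSum (summable_weight_ket hϑ) (ket k))
  convert hasSum_single (f := fun n => inner ℂ (ket n) (ket k) • (weight ϑ n : ℂ) • ket n) k
    (fun n hn => by rw [inner_ket_ket, if_neg hn, zero_smul]) using 1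
  rw [inner_ket_ket, if_pos rfl, one_smul]

/-- Each number state acquires a phase of modulus one, which cancels in its rank-one projection.
Hence the state does not depend on `θ`. -/
theorem rotation_conj_boltzmann {ϑ : ℝ} (hϑ : 0 < ϑ) (θ : ℝ) :
    rotation θ * boltzmann ϑ * ContinuousLinearMap.adjoint (rotation θ) = boltzmann ϑ := by
  rw [boltzmann_eq_nuclear hϑ, conj_nuclear (summable_weight_ket hϑ)]
  refine tsum_congr fun n => ?_
  set z := Complex.exp (((-(θ * (n + 1 / 2)) : ℝ) : ℂ) * Complex.I) with hz
  have h1 : ‖z‖ = 1 := Complex.norm_exp_ofReal_mul_I _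
  have h2 : (starRingEnd ℂ) z * z = 1 := by
    rw [← Complex.normSq_eq_conj_mul_self, Complex.normSq_eq_norm_sq, h1]; simp
  ext1 x
  rw [InnerProductSpace.rankOne_apply, InnerProductSpace.rankOne_apply]
  dsimp only
  rw [map_smul, rotation_ket,
    ← hz, inner_smul_left, smul_smul, smul_smul, smul_smul]
  congr 1
  linear_combination (inner ℂ (ket n) x * (weight ϑ n : ℂ)) * h2

theorem hasTrace_boltzmann {ϑ : ℝ} (hϑ : 0 < ϑ) : HasTrace (boltzmann ϑ) (zReal ϑ : ℂ) := by
  rw [boltzmann_eq_nuclear hϑ]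
  refine hasTrace_nuclear (summable_weight_ket hϑ) ?_
  refine (Complex.hasSum_ofReal.2 (hasSum_weight hϑ)).congr_fun fun n => ?_
  rw [inner_smul_right, inner_ket_ket, if_pos rfl, mul_one]

theorem partitionFn_eq {ϑ : ℝ} (hϑ : 0 < ϑ) : partitionFn ϑ = (zReal ϑ : ℂ) :=
  (hasTrace_boltzmann hϑ).opTrace_eq

theorem boltzmann_isPositive {ϑ : ℝ} (hϑ : 0 < ϑ) : (boltzmann ϑ).IsPositive := by
  rw [ContinuousLinearMap.isPositive_iff_complex]
  intro x
  have h := inner_nuclear_hasSum (summable_weight_ket hϑ) x x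
  rw [← boltzmann_eq_nuclear hϑ] at h
  have e : ∀ n, ((weight ϑ n * Complex.normSq (inner ℂ (ket n) x) : ℝ) : ℂ)
      = inner ℂ (ket n) x * inner ℂ x ((weight ϑ n : ℂ) • ket n) := fun n => by
    rw [inner_smul_right, ← inner_conj_symm x]
    push_cast
    rw [Complex.normSq_eq_conj_mul_self]; ring
  have h' := h.congr_fun e
  have hre := (Complex.hasSum_re h')
  simp only [Complex.ofReal_re] at hre
  have h2 : inner ℂ x (boltzmann ϑ x) = (((inner ℂ x (boltzmann ϑ x) : ℂ).re : ℝ) : ℂ) :=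
    h'.unique (Complex.hasSum_ofReal.2 hre)
  have h3 : inner ℂ (boltzmann ϑ x) x = inner ℂ x (boltzmann ϑ x) := by
    rw [← inner_conj_symm, h2, Complex.conj_ofReal]
  rw [h3]
  exact ⟨h2.symm, hre.nonneg fun n => mul_nonneg (weight_pos ϑ n).le (Complex.normSq_nonneg _)⟩

/-! ### The squeezed thermal state -/

theorem exists_squeeze_semigroup (ζ : ℂ) :
    ∃ U : ℝ≥0 → (Fock →L[ℂ] Fock), IsC0Semigroup U ∧ Generates (squeezeGen ζ) U ∧
      U 1 = squeeze ζ ∧ ContinuousLinearMap.adjoint (squeeze ζ) * squeeze ζ = 1 := by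
  obtain ⟨U, hU, hUG, h1, -⟩ := exists_unitary_semigroup (quadGrowth_squeezeGen ζ)
    (isAdj_squeezeGen ζ)
  have e : squeeze ζ = U 1 := opExp_eq_of_semigroup (quadGrowth_squeezeGen ζ) hU hUG
  exact ⟨U, hU, hUG, e.symm, by rw [e]; exact h1 1⟩

theorem adjoint_squeeze_mul_squeeze (ζ : ℂ) :
    ContinuousLinearMap.adjoint (squeeze ζ) * squeeze ζ = 1 := by
  obtain ⟨U, -, -, -, h⟩ := exists_squeeze_semigroup ζ
  exact h

theorem inner_squeeze_squeeze (ζ : ℂ) (x y : Fock) :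
    inner ℂ (squeeze ζ x) (squeeze ζ y) = inner ℂ x y := by
  rw [← ContinuousLinearMap.adjoint_inner_right, ← mul_apply_eq_comp,
    adjoint_squeeze_mul_squeeze, one_apply_eq_self]

theorem dress_boltzmann {ϑ : ℝ} (hϑ : 0 < ϑ) (ζ : ℂ) (θ : ℝ) :
    dress ζ θ (boltzmann ϑ) = squeeze ζ * boltzmann ϑ * ContinuousLinearMap.adjoint (squeeze ζ) := by
  conv_rhs => rw [← rotation_conj_boltzmann hϑ θ]
  simp only [dress, mul_assoc]

theorem dress_boltzmann_eq_nuclear {ϑ : ℝ} (hϑ : 0 < ϑ) (ζ : ℂ) (θ : ℝ) :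
    dress ζ θ (boltzmann ϑ) =
      nuclear (fun n => squeeze ζ ((weight ϑ n : ℂ) • ket n)) (fun n => squeeze ζ (ket n)) := by
  rw [dress_boltzmann hϑ, boltzmann_eq_nuclear hϑ, conj_nuclear (summable_weight_ket hϑ)]

theorem hasTrace_dress_boltzmann {ϑ : ℝ} (hϑ : 0 < ϑ) (ζ : ℂ) (θ : ℝ) :
    HasTrace (dress ζ θ (boltzmann ϑ)) (zReal ϑ : ℂ) := by
  rw [dress_boltzmann_eq_nuclear hϑ]
  refine hasTrace_nuclear (summable_norm_conj (summable_weight_ket hϑ) _ _) ?_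
  refine (Complex.hasSum_ofReal.2 (hasSum_weight hϑ)).congr_fun fun n => ?_
  rw [inner_squeeze_squeeze, inner_smul_right, inner_ket_ket, if_pos rfl, mul_one]

theorem squeezedThermal_eq {ϑ : ℝ} (hϑ : 0 < ϑ) (ζ : ℂ) (θ : ℝ) :
    squeezedThermal ϑ ζ θ = (((zReal ϑ)⁻¹ : ℝ) : ℂ) • dress ζ θ (boltzmann ϑ) := by
  simp only [squeezedThermal, thermalState, dress, partitionFn_eq hϑ, mul_smul_comm, smul_mul_assoc,
    Complex.ofReal_inv]

theorem squeezedThermal_isPositive {ϑ : ℝ} (hϑ : 0 < ϑ) (ζ : ℂ) (θ : ℝ) :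
    (squeezedThermal ϑ ζ θ).IsPositive := by
  rw [squeezedThermal_eq hϑ, dress_boltzmann hϑ]
  refine ContinuousLinearMap.IsPositive.smul_of_nonneg
    ((boltzmann_isPositive hϑ).conj_adjoint (squeeze ζ)) ?_
  have := zReal_pos hϑ
  rw [Complex.zero_le_real]
  positivity

theorem hasTrace_squeezedThermal {ϑ : ℝ} (hϑ : 0 < ϑ) (ζ : ℂ) (θ : ℝ) :
    HasTrace (squeezedThermal ϑ ζ θ) 1 := by
  have h := (hasTrace_dress_boltzmann hϑ ζ θ).smul (((zReal ϑ)⁻¹ : ℝ) : ℂ)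
  rw [← squeezedThermal_eq hϑ, ← Complex.ofReal_mul, inv_mul_cancel₀ (zReal_pos hϑ).ne'] at h
  simpa using h

/-- The expectation of an operator `A` whose adjoint is carried by `S(ζ)` to the adjoint of `C`. -/
theorem hasExpectation_of_heisenberg {ϑ : ℝ} (hϑ : 0 < ϑ) (ζ : ℂ) (θ : ℝ)
    {A C : Module.End ℂ Fin0} (hC : QuadGrowth C)
    (hA : ∀ w v, inner ℂ (squeeze ζ (incl (C w))) (incl v) =
      inner ℂ (squeeze ζ (incl w)) (incl (A v))) {τ : ℂ}
    (hτ : HasSum (fun n => (weight ϑ n : ℂ) * (starRingEnd ℂ) (C (Finsupp.single n 1) n))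
      (zReal ϑ * τ)) :
    HasExpectation (squeezedThermal ϑ ζ θ) A τ := by
  obtain ⟨c, hc, hC⟩ := hC
  -- The state `|n⟩` has degree below `n + 1`, so `‖C |n⟩‖ ≤ c (n + 2)`; the weights have a finite
  -- first moment.
  have hs : Summable fun n => ‖(weight ϑ n : ℂ) • ket n‖ * ‖incl (C (Finsupp.single n 1))‖ := by
    refine Summable.of_nonneg_of_le (fun n => by positivity) (fun n => ?_)
      (((hasSum_weight_mul hϑ).add ((hasSum_weight hϑ).mul_right 2)).summable.mul_left c)
    have h1 := (hC (n + 1) (Finsupp.single n 1)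
      (fun k hk => Finsupp.single_eq_of_ne (by omega))).2
    rw [incl_single_one, norm_ket, mul_one] at h1
    rw [norm_weight_smul_ket]
    calc weight ϑ n * ‖incl (C (Finsupp.single n 1))‖
        ≤ weight ϑ n * (c * (((n + 1 : ℕ) : ℝ) + 1)) := by
          gcongr
          exact (weight_pos ϑ n).le
      _ = _ := by push_cast; ring
  have hs' := summable_norm_conj hs (squeeze ζ) (squeeze ζ)
  -- In `ρ (A v)` the coefficient `⟨S n, A v⟩` equals `⟨S C n, v⟩`, so moving `A` into the
  -- right-hand vectors gives a bounded extension of `ρ A`. Since `S` is isometric, its trace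
  -- reduces to the weighted diagonal of `C`, conjugated.
  refine ⟨(((zReal ϑ)⁻¹ : ℝ) : ℂ) • nuclear (fun n => squeeze ζ ((weight ϑ n : ℂ) • ket n))
    (fun n => squeeze ζ (incl (C (Finsupp.single n 1)))), fun v => ?_, ?_⟩
  · rw [squeezedThermal_eq hϑ, smul_apply, smul_apply, dress_boltzmann_eq_nuclear hϑ]
    congr 1
    refine (nuclear_apply_hasSum hs' (incl v)).unique
      ((nuclear_apply_hasSum (summable_norm_conj (summable_weight_ket hϑ) _ _)
        (incl (A v))).congr_fun fun n => ?_)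
    rw [hA, incl_single_one]
  · have h := (hasTrace_nuclear hs' (τ := zReal ϑ * τ) (hτ.congr_fun fun n => ?_)).smul
      (((zReal ϑ)⁻¹ : ℝ) : ℂ)
    · rwa [← mul_assoc, ← Complex.ofReal_mul, inv_mul_cancel₀ (zReal_pos hϑ).ne',
        Complex.ofReal_one, one_mul] at h
    · rw [inner_squeeze_squeeze, inner_smul_right, ← inner_conj_symm, inner_ket, incl_apply]

theorem HasExpectation.add {ρ : Fock →L[ℂ] Fock} {A B : Module.End ℂ Fin0} {μ ν : ℂ}
    (h : HasExpectation ρ A μ) (h' : HasExpectation ρ B ν) : HasExpectation ρ (A + B) (μ + ν) := by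
  obtain ⟨T, hT, hμ⟩ := h
  obtain ⟨S, hS, hν⟩ := h'
  refine ⟨T + S, fun v => by simp [hT, hS], fun e => ?_⟩
  simpa [inner_add_right] using (hμ e).add (hν e)

theorem HasExpectation.smul {ρ : Fock →L[ℂ] Fock} {A : Module.End ℂ Fin0} {μ : ℂ}
    (h : HasExpectation ρ A μ) (z : ℂ) : HasExpectation ρ (z • A) (z * μ) := by
  obtain ⟨T, hT, hμ⟩ := h
  exact ⟨z • T, fun v => by simp [hT], hμ.smul z⟩

/-! ### Commutators with the squeeze generator -/

section Algebra

variable {R : Type*} [Ring R] [Algebra ℂ R]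

/-- Both identities come from `[a, c²] = 2c` and `[a², c] = 2a`. -/
theorem comm_of_ladder {a c : R} (h : a * c = c * a + 1) (p q : ℂ) :
    (p • a ^ 2 - q • c ^ 2) * a = a * (p • a ^ 2 - q • c ^ 2) + (2 * q) • c ∧
      (p • a ^ 2 - q • c ^ 2) * c = c * (p • a ^ 2 - q • c ^ 2) + (2 * p) • a := by
  have h1 : c ^ 2 * a = a * c ^ 2 - (2 : ℂ) • c := by
    have e : a * c ^ 2 = c ^ 2 * a + (2 : ℂ) • c := by
      rw [sq, ← mul_assoc, h, add_mul, mul_assoc, h, two_smul]; noncomm_ring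
    rw [e]; abel
  have h2 : a ^ 2 * c = c * a ^ 2 + (2 : ℂ) • a := by
    rw [sq, mul_assoc, h, mul_add, ← mul_assoc, h, two_smul]; noncomm_ring
  constructor
  · rw [sub_mul, mul_sub, smul_mul_assoc, smul_mul_assoc, h1, mul_smul_comm, mul_smul_comm,
      smul_sub, smul_smul, ← pow_succ, ← pow_succ']
    module
  · rw [sub_mul, mul_sub, smul_mul_assoc, smul_mul_assoc, h2, mul_smul_comm, mul_smul_comm,
      smul_add, smul_smul, ← pow_succ, ← pow_succ']
    module

/-- The commutator with `G` is a derivation, so the evolution equation for products follows from the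
linear one by the Leibniz rule. The scalars `-(ξ * Y)` and `-(ζ * X)` stand for the time derivatives
of `X` and `Y`, and likewise for the primed pair. -/
theorem ladder_comm_quadratic {a c G : R} {ζ ξ : ℂ} (ha : G * a = a * G + ζ • c)
    (hc : G * c = c * G + ξ • a) (X Y X' Y' : ℂ) :
    (((-(ξ * Y)) * X' + X * (-(ξ * Y'))) • (a * a) +
      ((-(ξ * Y)) * Y' + X * (-(ζ * X'))) • (a * c) +
      ((-(ζ * X)) * X' + Y * (-(ξ * Y'))) • (c * a) +
      ((-(ζ * X)) * Y' + Y * (-(ζ * X'))) • (c * c)) +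
      G * ((X * X') • (a * a) + (X * Y') • (a * c) + (Y * X') • (c * a) + (Y * Y') • (c * c)) =
    ((X * X') • (a * a) + (X * Y') • (a * c) + (Y * X') • (c * a) + (Y * Y') • (c * c)) * G := by
  have key : ∀ {x y x' y' : R}, G * x = x * G + x' → G * y = y * G + y' →
      G * (x * y) = x * y * G + (x * y' + x' * y) := by
    intro x y x' y' hx hy
    rw [← mul_assoc, hx, add_mul, mul_assoc, hy]; noncomm_ring
  rw [mul_add, mul_add, mul_add, add_mul, add_mul, add_mul]
  simp only [mul_smul_comm, smul_mul_assoc]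
  rw [key ha ha, key ha hc, key hc ha, key hc hc]
  simp only [mul_smul_comm, smul_mul_assoc]
  module

theorem linear_mul_linear (a c : R) (x y x' y' : ℂ) :
    (x • a + y • c) * (x' • a + y' • c) =
      (x * x') • (a * a) + (x * y') • (a * c) + (y * x') • (c * a) + (y * y') • (c * c) := by
  simp only [add_mul, mul_add, smul_mul_assoc, mul_smul_comm]
  module

end Algebra

theorem squeezeGen_mul_ann (ζ : ℂ) : squeezeGen ζ * ann = ann * squeezeGen ζ + ζ • cre := by
  have h := (comm_of_ladder (R := Module.End ℂ Fin0) ann_mul_cre ((1 / 2 : ℂ) * (starRingEnd ℂ) ζ) ((1 / 2 : ℂ) * ζ)).1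
  rw [show (2 : ℂ) * (1 / 2 * ζ) = ζ by ring] at h
  exact h

theorem squeezeGen_mul_cre (ζ : ℂ) :
    squeezeGen ζ * cre = cre * squeezeGen ζ + (starRingEnd ℂ) ζ • ann := by
  have h := (comm_of_ladder (R := Module.End ℂ Fin0) ann_mul_cre ((1 / 2 : ℂ) * (starRingEnd ℂ) ζ) ((1 / 2 : ℂ) * ζ)).2
  rw [show (2 : ℂ) * (1 / 2 * (starRingEnd ℂ) ζ) = (starRingEnd ℂ) ζ by ring] at h
  exact h

/-! ### Bogoliubov transformation of the ladder operators -/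

/-- A linear combination `x a + y a†` of the ladder operators. -/
noncomputable def lin (x y : ℂ) : Module.End ℂ Fin0 := x • ann + y • cre

theorem isAdj_lin (x y : ℂ) : IsAdj (lin x y) (lin ((starRingEnd ℂ) y) ((starRingEnd ℂ) x)) := by
  have h := (isAdj_ann_cre.smul x).add (isAdj_ann_cre.symm.smul y)
  rw [add_comm ((starRingEnd ℂ) x • cre)] at h
  exact h

theorem lin_mul_lin (x y x' y' : ℂ) : lin x y * lin x' y' =
    (x * x') • (ann * ann) + (x * y') • (ann * cre) + (y * x') • (cre * ann) +
      (y * y') • (cre * cre) :=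
  linear_mul_linear (R := Module.End ℂ Fin0) ann cre x y x' y'

/-- The coefficient of `a` in `S(tζ)† (x a + y a†) S(tζ)`, where `ζ = r u`. -/
noncomputable def annCoeff (r : ℝ) (u x y : ℂ) (t : ℝ) : ℂ :=
  x * (Real.cosh (r * t) : ℂ) - y * (starRingEnd ℂ) u * (Real.sinh (r * t) : ℂ)

/-- The coefficient of `a†` in `S(tζ)† (x a + y a†) S(tζ)`, where `ζ = r u`. -/
noncomputable def creCoeff (r : ℝ) (u x y : ℂ) (t : ℝ) : ℂ :=
  y * (Real.cosh (r * t) : ℂ) - x * u * (Real.sinh (r * t) : ℂ)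

theorem annCoeff_zero (r : ℝ) (u x y : ℂ) : annCoeff r u x y 0 = x := by simp [annCoeff]

theorem creCoeff_zero (r : ℝ) (u x y : ℂ) : creCoeff r u x y 0 = y := by simp [creCoeff]

/-- Evolution commutes with taking adjoints, which exchanges the two coefficients. This removes the
conjugates that arise because the weak Heisenberg picture evolves the adjoint of the observable. -/
theorem conj_annCoeff (r : ℝ) (u x y : ℂ) (t : ℝ) :
    (starRingEnd ℂ) (annCoeff r u ((starRingEnd ℂ) y) ((starRingEnd ℂ) x) t) =
      creCoeff r u x y t := by
  simp only [annCoeff, creCoeff, map_sub, map_mul, Complex.conj_conj, Complex.conj_ofReal]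

theorem conj_creCoeff (r : ℝ) (u x y : ℂ) (t : ℝ) :
    (starRingEnd ℂ) (creCoeff r u ((starRingEnd ℂ) y) ((starRingEnd ℂ) x) t) =
      annCoeff r u x y t := by
  simp only [annCoeff, creCoeff, map_sub, map_mul, Complex.conj_conj, Complex.conj_ofReal]

theorem hasDerivAt_cosh_mul (r t : ℝ) :
    HasDerivAt (fun t : ℝ => (Real.cosh (r * t) : ℂ)) ((r * Real.sinh (r * t) : ℝ) : ℂ) t := by
  have h := ((hasDerivAt_id t).const_mul r).cosh
  refine (h.congr_deriv ?_).ofReal_comp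
  simp [mul_comm]

theorem hasDerivAt_sinh_mul (r t : ℝ) :
    HasDerivAt (fun t : ℝ => (Real.sinh (r * t) : ℂ)) ((r * Real.cosh (r * t) : ℝ) : ℂ) t := by
  have h := ((hasDerivAt_id t).const_mul r).sinh
  refine (h.congr_deriv ?_).ofReal_comp
  simp [mul_comm]

section Heisenberg

variable {r : ℝ} {u : ℂ} (hu : u * (starRingEnd ℂ) u = 1)
include hu

/-- The system is `X' = -ζ* Y`, `Y' = -ζ X` with `ζ = r u`; the hyperbolic functions solve it
because `|u| = 1`. -/
theorem hasDerivAt_annCoeff (x y : ℂ) (t : ℝ) :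
    HasDerivAt (annCoeff r u x y)
      (-((starRingEnd ℂ) (r * u) * creCoeff r u x y t)) t := by
  have h := ((hasDerivAt_cosh_mul r t).const_mul x).sub
    ((hasDerivAt_sinh_mul r t).const_mul (y * (starRingEnd ℂ) u))
  refine h.congr_deriv ?_
  simp only [creCoeff, map_mul, Complex.conj_ofReal]
  push_cast
  linear_combination (-(r * x * Complex.sinh (r * t))) * hu

theorem hasDerivAt_creCoeff (x y : ℂ) (t : ℝ) :
    HasDerivAt (creCoeff r u x y) (-(r * u * annCoeff r u x y t)) t := by
  have h := ((hasDerivAt_cosh_mul r t).const_mul y).sub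
    ((hasDerivAt_sinh_mul r t).const_mul (x * u))
  refine h.congr_deriv ?_
  simp only [annCoeff]
  push_cast
  linear_combination (-(r * y * Complex.sinh (r * t))) * hu

theorem inner_squeeze_lin {x y : ℂ} {A : Module.End ℂ Fin0} (hA : IsAdj (lin x y) A)
    (w v : Fin0) :
    inner ℂ (squeeze (r * u) (incl (lin (annCoeff r u x y 1) (creCoeff r u x y 1) w))) (incl v) =
      inner ℂ (squeeze (r * u) (incl w)) (incl (A v)) := by
  obtain ⟨U, hU, hUG, h1, -⟩ := exists_squeeze_semigroup (r * u)
  have key := inner_semigroup_heisenberg (quadGrowth_squeezeGen (r * u)) hU hUG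
    (D := ![ann, cre])
    (h := ![annCoeff r u x y, creCoeff r u x y])
    (h' := ![fun t => -((starRingEnd ℂ) (r * u) * creCoeff r u x y t),
      fun t => -(r * u * annCoeff r u x y t)])
    (by
      intro i
      fin_cases i
      · exact linGrowth_ann.quadGrowth
      · exact linGrowth_cre.quadGrowth)
    (by
      intro i t
      fin_cases i
      · exact hasDerivAt_annCoeff hu x y t
      · exact hasDerivAt_creCoeff hu x y t)
    (by
      intro t
      simp only [Fin.sum_univ_two, Matrix.cons_val_zero, Matrix.cons_val_one]
      rw [mul_add, add_mul]
      simp only [mul_smul_comm, smul_mul_assoc]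
      rw [squeezeGen_mul_ann, squeezeGen_mul_cre]
      module)
    (A := A)
    (by
      simp only [Fin.sum_univ_two, Matrix.cons_val_zero, Matrix.cons_val_one, annCoeff_zero,
        creCoeff_zero]
      exact hA) 1 w v
  simp only [Fin.sum_univ_two, Matrix.cons_val_zero, Matrix.cons_val_one, h1, NNReal.coe_one]
    at key
  exact key

theorem inner_squeeze_lin_mul_lin {x y x' y' : ℂ} {A : Module.End ℂ Fin0}
    (hA : IsAdj (lin x y * lin x' y') A) (w v : Fin0) :
    inner ℂ (squeeze (r * u) (incl ((lin (annCoeff r u x y 1) (creCoeff r u x y 1) *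
      lin (annCoeff r u x' y' 1) (creCoeff r u x' y' 1)) w))) (incl v) =
      inner ℂ (squeeze (r * u) (incl w)) (incl (A v)) := by
  obtain ⟨U, hU, hUG, h1, -⟩ := exists_squeeze_semigroup (r * u)
  have key := inner_semigroup_heisenberg (quadGrowth_squeezeGen (r * u)) hU hUG
    (D := ![ann * ann, ann * cre, cre * ann, cre * cre])
    (h := ![fun t => annCoeff r u x y t * annCoeff r u x' y' t,
      fun t => annCoeff r u x y t * creCoeff r u x' y' t,
      fun t => creCoeff r u x y t * annCoeff r u x' y' t,
      fun t => creCoeff r u x y t * creCoeff r u x' y' t])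
    (h' := ![fun t => -((starRingEnd ℂ) (r * u) * creCoeff r u x y t) * annCoeff r u x' y' t +
        annCoeff r u x y t * -((starRingEnd ℂ) (r * u) * creCoeff r u x' y' t),
      fun t => -((starRingEnd ℂ) (r * u) * creCoeff r u x y t) * creCoeff r u x' y' t +
        annCoeff r u x y t * -(r * u * annCoeff r u x' y' t),
      fun t => -(r * u * annCoeff r u x y t) * annCoeff r u x' y' t +
        creCoeff r u x y t * -((starRingEnd ℂ) (r * u) * creCoeff r u x' y' t),
      fun t => -(r * u * annCoeff r u x y t) * creCoeff r u x' y' t +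
        creCoeff r u x y t * -(r * u * annCoeff r u x' y' t)])
    (by
      intro i
      fin_cases i
      · exact linGrowth_ann.mul linGrowth_ann
      · exact linGrowth_ann.mul linGrowth_cre
      · exact linGrowth_cre.mul linGrowth_ann
      · exact linGrowth_cre.mul linGrowth_cre)
    (by
      intro i t
      fin_cases i
      · exact (hasDerivAt_annCoeff hu x y t).mul (hasDerivAt_annCoeff hu x' y' t)
      · exact (hasDerivAt_annCoeff hu x y t).mul (hasDerivAt_creCoeff hu x' y' t)
      · exact (hasDerivAt_creCoeff hu x y t).mul (hasDerivAt_annCoeff hu x' y' t)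
      · exact (hasDerivAt_creCoeff hu x y t).mul (hasDerivAt_creCoeff hu x' y' t))
    (by
      intro t
      simp only [Fin.sum_univ_four, Matrix.cons_val]
      exact ladder_comm_quadratic (R := Module.End ℂ Fin0) (squeezeGen_mul_ann _) (squeezeGen_mul_cre _) _ _ _ _)
    (A := A)
    (by
      simp only [Fin.sum_univ_four, Matrix.cons_val, annCoeff_zero, creCoeff_zero]
      rw [← lin_mul_lin]
      exact hA) 1 w v
  simp only [Fin.sum_univ_four, Matrix.cons_val, h1, NNReal.coe_one] at key
  rw [← lin_mul_lin] at key
  exact key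

end Heisenberg

/-! ### Diagonal elements and thermal expectations -/

theorem lin_single_apply_self (x y : ℂ) (n : ℕ) : lin x y (Finsupp.single n 1) n = 0 := by
  rw [lin, LinearMap.add_apply, Finsupp.add_apply, LinearMap.smul_apply, LinearMap.smul_apply,
    Finsupp.smul_apply, Finsupp.smul_apply, ann_apply, Finsupp.single_eq_of_ne (by omega)]
  rcases n with _ | n
  · simp [cre_apply_zero]
  · rw [cre_apply_succ, Finsupp.single_eq_of_ne (by omega)]
    simp

/-- Only the degree-preserving products reach the diagonal: `a a†` contributes `n + 1` and `a† a`
contributes `n`. -/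
theorem lin_mul_lin_single_apply_self (x y x' y' : ℂ) (n : ℕ) :
    (lin x y * lin x' y') (Finsupp.single n 1) n = x * y' * (n + 1) + y * x' * n := by
  have h1 : (ann * ann) (Finsupp.single n 1) n = 0 := by
    rw [Module.End.mul_apply, ann_apply, ann_apply, Finsupp.single_eq_of_ne (by omega)]; simp
  have h2 : (cre * cre) (Finsupp.single n 1) n = 0 := by
    rw [Module.End.mul_apply]
    rcases n with _ | _ | n
    · simp [cre_apply_zero]
    · rw [cre_apply_succ, cre_apply_zero, mul_zero]
    · rw [cre_apply_succ, cre_apply_succ, Finsupp.single_eq_of_ne (by omega)]; simp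
  rw [lin_mul_lin]
  simp only [LinearMap.add_apply, Finsupp.add_apply, LinearMap.smul_apply, Finsupp.smul_apply, h1,
    h2, ann_mul_cre_apply, cre_mul_ann_apply, Finsupp.single_eq_same, smul_eq_mul]
  ring

theorem linGrowth_lin (x y : ℂ) : LinGrowth (lin x y) := by
  obtain ⟨c, hc, h⟩ := linGrowth_ann
  obtain ⟨d, hd, h'⟩ := linGrowth_cre
  refine ⟨‖x‖ * c + ‖y‖ * d, by positivity, fun m v hv => ⟨fun n hn => ?_, ?_⟩⟩
  · simp [lin, (h m v hv).1 n hn, (h' m v hv).1 n hn]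
  · rw [lin, LinearMap.add_apply, map_add, LinearMap.smul_apply, LinearMap.smul_apply, map_smul,
      map_smul]
    refine (norm_add_le _ _).trans ?_
    rw [norm_smul, norm_smul]
    calc ‖x‖ * ‖incl (ann v)‖ + ‖y‖ * ‖incl (cre v)‖
        ≤ ‖x‖ * (c * √(m + 1) * ‖incl v‖) + ‖y‖ * (d * √(m + 1) * ‖incl v‖) := by
          gcongr
          · exact (h m v hv).2
          · exact (h' m v hv).2
      _ = _ := by ring

section Expectation

variable {ϑ : ℝ} (hϑ : 0 < ϑ) {u : ℂ} (hu : u * (starRingEnd ℂ) u = 1) (r θ : ℝ)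
include hϑ hu

/-- The evolved operator is again linear in the ladder operators, so it shifts the degree by one and
has zero diagonal. -/
theorem hasExpectation_lin (x y : ℂ) :
    HasExpectation (squeezedThermal ϑ (r * u) θ) (lin x y) 0 := by
  refine hasExpectation_of_heisenberg hϑ (r * u) θ (linGrowth_lin _ _).quadGrowth
    (inner_squeeze_lin hu (isAdj_lin x y).symm) ?_
  simp only [lin_single_apply_self, map_zero, mul_zero]
  exact hasSum_zero

/-- The thermal means of `a a†` and `a† a` are `ν + 1/2` and `ν - 1/2`, where `ν = halfCoth ϑ`. -/
theorem hasExpectation_lin_mul_lin (x y x' y' : ℂ) :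
    HasExpectation (squeezedThermal ϑ (r * u) θ) (lin x y * lin x' y')
      (annCoeff r u x y 1 * creCoeff r u x' y' 1 * (halfCoth ϑ + 1 / 2) +
        creCoeff r u x y 1 * annCoeff r u x' y' 1 * (halfCoth ϑ - 1 / 2)) := by
  refine hasExpectation_of_heisenberg hϑ (r * u) θ ((linGrowth_lin _ _).mul (linGrowth_lin _ _))
    (inner_squeeze_lin_mul_lin hu ((isAdj_lin x y).mul (isAdj_lin x' y')).symm) ?_
  have h0 := Complex.hasSum_ofReal.2 (hasSum_weight hϑ)
  have h1 := Complex.hasSum_ofReal.2 (hasSum_weight_mul hϑ)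
  have h := ((h1.add h0).mul_left (annCoeff r u x y 1 * creCoeff r u x' y' 1)).add
    (h1.mul_left (creCoeff r u x y 1 * annCoeff r u x' y' 1))
  have e : annCoeff r u x y 1 * creCoeff r u x' y' 1 *
        (((zReal ϑ * (halfCoth ϑ - 1 / 2) : ℝ) : ℂ) + zReal ϑ) +
      creCoeff r u x y 1 * annCoeff r u x' y' 1 * ((zReal ϑ * (halfCoth ϑ - 1 / 2) : ℝ) : ℂ) =
      zReal ϑ * (annCoeff r u x y 1 * creCoeff r u x' y' 1 * (halfCoth ϑ + 1 / 2) +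
        creCoeff r u x y 1 * annCoeff r u x' y' 1 * (halfCoth ϑ - 1 / 2)) := by
    push_cast; ring
  rw [← e]
  refine h.congr_fun fun n => ?_
  rw [lin_mul_lin_single_apply_self]
  simp only [map_add, map_mul, conj_annCoeff, conj_creCoeff, map_natCast, map_one]
  push_cast; ring

end Expectation

/-! ### The covariance matrix -/

theorem pos_eq_lin (m ω : ℝ) : pos m ω =
    lin ((1 / Real.sqrt (2 * m * ω) : ℝ) : ℂ) ((1 / Real.sqrt (2 * m * ω) : ℝ) : ℂ) := by
  rw [pos, lin, smul_add, add_comm]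

theorem mom_eq_lin (m ω : ℝ) : mom m ω =
    lin (-(Complex.I * ((Real.sqrt (m * ω / 2) : ℝ) : ℂ)))
      (Complex.I * ((Real.sqrt (m * ω / 2) : ℝ) : ℂ)) := by
  rw [mom, lin, end_sub_eq_add_smul, smul_add, smul_smul, add_comm]
  congr 2
  ring

theorem HasExpectation.of_eq {ρ : Fock →L[ℂ] Fock} {A : Module.End ℂ Fin0} {μ ν : ℂ}
    (h : HasExpectation ρ A μ) (e : μ = ν) : HasExpectation ρ A ν := e ▸ h

section Covariance

variable {m ω : ℝ} (hm : 0 < m) (hω : 0 < ω)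
include hm hω

theorem inv_sqrt_sq : (((1 / Real.sqrt (2 * m * ω) : ℝ) : ℂ)) ^ 2 = 1 / (2 * (m * ω)) := by
  rw [← Complex.ofReal_pow, div_pow, one_pow, Real.sq_sqrt (by positivity)]
  push_cast; ring

theorem sqrt_half_sq : ((Real.sqrt (m * ω / 2) : ℝ) : ℂ) ^ 2 = m * ω / 2 := by
  rw [← Complex.ofReal_pow, Real.sq_sqrt (by positivity)]
  push_cast; ring

theorem inv_sqrt_mul_sqrt_half :
    ((1 / Real.sqrt (2 * m * ω) : ℝ) : ℂ) * ((Real.sqrt (m * ω / 2) : ℝ) : ℂ) = 1 / 2 := by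
  have h1 : Real.sqrt (2 * m * ω) = 2 * Real.sqrt (m * ω / 2) := by
    rw [show 2 * m * ω = 2 ^ 2 * (m * ω / 2) by ring, Real.sqrt_mul (by positivity),
      Real.sqrt_sq (by norm_num)]
  have h2 : Real.sqrt (m * ω / 2) ≠ 0 := by positivity
  rw [← Complex.ofReal_mul, h1]
  have : 1 / (2 * Real.sqrt (m * ω / 2)) * Real.sqrt (m * ω / 2) = 1 / 2 := by field_simp
  rw [this]; push_cast; rfl

/-- The covariance matrix of the squeezed thermal state, for `ζ = r u` with `|u| = 1`. -/
theorem hasCovariance_squeezedThermal {ϑ : ℝ} (hϑ : 0 < ϑ) {p q : ℝ} (hpq : p ^ 2 + q ^ 2 = 1)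
    (r θ : ℝ) :
    HasCovariance m ω (squeezedThermal ϑ (r * (p + q * Complex.I)) θ)
      (m * ω * halfCoth ϑ * (Real.cosh (2 * r) + Real.sinh (2 * r) * p))
      (halfCoth ϑ / (m * ω) * (Real.cosh (2 * r) - Real.sinh (2 * r) * p))
      (-(halfCoth ϑ * (Real.sinh (2 * r) * q))) := by
  have hpqC : (p : ℂ) ^ 2 + (q : ℂ) ^ 2 = 1 := by exact_mod_cast hpq
  have hconj : (starRingEnd ℂ) ((p : ℂ) + q * Complex.I) = p - q * Complex.I := by
    simp only [map_add, map_mul, Complex.conj_ofReal, Complex.conj_I]; ring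
  have hu : ((p : ℂ) + q * Complex.I) * (starRingEnd ℂ) ((p : ℂ) + q * Complex.I) = 1 := by
    rw [hconj]; linear_combination hpqC - (q : ℂ) ^ 2 * Complex.I_sq
  have hX : (m : ℂ) * ω ≠ 0 := by
    exact_mod_cast (mul_pos hm hω).ne'
  have hs := inv_sqrt_sq hm hω
  have hσ := sqrt_half_sq hm hω
  have hsσ := inv_sqrt_mul_sqrt_half hm hω
  set s : ℂ := ((1 / Real.sqrt (2 * m * ω) : ℝ) : ℂ) with hs_def
  set σ : ℂ := ((Real.sqrt (m * ω / 2) : ℝ) : ℂ) with hσ_def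
  have key := hasExpectation_lin_mul_lin hϑ hu r θ
  rw [Real.cosh_two_mul, Real.sinh_two_mul]
  set C : ℂ := (Real.cosh r : ℂ) with hC
  set S : ℂ := (Real.sinh r : ℂ) with hS
  have hI := Complex.I_sq
  refine ⟨?_, ?_, ?_⟩
  -- The evolved coefficients of `χ` are `s (C - u* S)` and its conjugate, so the value is `2 ν s²
  -- |C - u S|²`.
  · rw [sq, pos_eq_lin]
    refine (key s s s s).of_eq ?_
    simp only [annCoeff, creCoeff, hconj, mul_one]
    push_cast
    rw [← Complex.ofReal_cosh, ← Complex.ofReal_sinh, ← hC, ← hS]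
    have e : (halfCoth ϑ : ℂ) / (m * ω) = s ^ 2 * (2 * halfCoth ϑ) := by
      rw [hs]; field_simp
    rw [e]
    linear_combination (2 * s ^ 2 * (halfCoth ϑ : ℂ) * S ^ 2) * hpqC -
      (2 * s ^ 2 * (halfCoth ϑ : ℂ) * S ^ 2 * (q : ℂ) ^ 2) * hI
  · rw [sq, mom_eq_lin]
    refine (key _ _ _ _).of_eq ?_
    simp only [annCoeff, creCoeff, hconj, mul_one]
    push_cast
    rw [← Complex.ofReal_cosh, ← Complex.ofReal_sinh, ← hC, ← hS, ← hσ_def]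
    have e : (m : ℂ) * ω = 2 * σ ^ 2 := by rw [hσ]; ring
    rw [e]
    -- For `p` the sign of `S` is reversed; this is `|C + u S|²` expanded with `|u| = 1`.
    have e2 : ((C + (p - q * Complex.I) * S) * (C + (p + q * Complex.I) * S)) =
        C ^ 2 + S ^ 2 + 2 * S * C * p := by
      linear_combination S ^ 2 * hpqC - (S ^ 2 * (q : ℂ) ^ 2) * hI
    linear_combination (-(2 * (halfCoth ϑ : ℂ)) * σ ^ 2 * (C + (p - q * Complex.I) * S) *
      (C + (p + q * Complex.I) * S)) * hI + 2 * (halfCoth ϑ : ℂ) * σ ^ 2 * e2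
  · rw [pos_eq_lin, mom_eq_lin]
    refine (((key _ _ _ _).add (key _ _ _ _)).smul _).of_eq ?_
    rw [← hs_def, ← hσ_def]
    simp only [annCoeff, creCoeff, hconj, mul_one]
    push_cast
    rw [← Complex.ofReal_cosh, ← Complex.ofReal_sinh, ← hC, ← hS]
    linear_combination (4 * (halfCoth ϑ : ℂ) * S * C * q * Complex.I ^ 2) * hsσ +
      (2 * (halfCoth ϑ : ℂ) * S * C * q) * hI

end Covariance

/-! ### Recovering the parameters from the covariance matrix -/

theorem HasCovariance.unique {m ω : ℝ} {ρ : Fock →L[ℂ] Fock} {a b c a' b' c' : ℝ}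
    (h : HasCovariance m ω ρ a b c) (h' : HasCovariance m ω ρ a' b' c') :
    a = a' ∧ b = b' ∧ c = c' :=
  ⟨Complex.ofReal_injective (h.2.1.unique h'.2.1), Complex.ofReal_injective (h.1.unique h'.1),
    Complex.ofReal_injective (h.2.2.unique h'.2.2)⟩

theorem exists_polar (ζ : ℂ) :
    ∃ r p q : ℝ, 0 ≤ r ∧ p ^ 2 + q ^ 2 = 1 ∧ ζ = r * (p + q * Complex.I) := by
  refine ⟨‖ζ‖, Real.cos ζ.arg, Real.sin ζ.arg, norm_nonneg _, Real.cos_sq_add_sin_sq _, ?_⟩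
  rw [Complex.ofReal_cos, Complex.ofReal_sin, Complex.norm_mul_cos_add_sin_mul_I]

theorem exp_two_mul_phi {ϑ : ℝ} (hϑ : 0 < ϑ) : Real.exp (2 * phi ϑ) = 4 * halfCoth ϑ ^ 2 := by
  have h := sinh_half_pos hϑ
  have h2 := Real.cosh_pos (ϑ / 2)
  rw [phi, two_mul, Real.exp_add, Real.exp_log (by positivity), halfCoth]
  field_simp
  norm_num

theorem zReal_eq_sqrt {ϑ : ℝ} (hϑ : 0 < ϑ) : zReal ϑ = Real.sqrt (halfCoth ϑ ^ 2 - 1 / 4) := by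
  rw [halfCoth_sq hϑ, Real.sqrt_sq (zReal_pos hϑ).le]

/-- Squeezing is symplectic, so the determinant keeps its thermal value; concretely, `cosh² - sinh²
(p² + q²) = 1`. -/
theorem covariance_det {X ν r p q : ℝ} (hX : 0 < X) (hpq : p ^ 2 + q ^ 2 = 1) :
    X * ν * (Real.cosh (2 * r) + Real.sinh (2 * r) * p) *
      (ν / X * (Real.cosh (2 * r) - Real.sinh (2 * r) * p)) -
      (-(ν * (Real.sinh (2 * r) * q))) ^ 2 = ν ^ 2 := by
  have h := Real.cosh_sq (2 * r)
  field_simp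
  linear_combination ν ^ 2 * (h - Real.sinh (2 * r) ^ 2 * hpq)

theorem cosh_sub_sinh_mul_pos {x p q : ℝ} (hpq : p ^ 2 + q ^ 2 = 1) :
    0 < Real.cosh x - Real.sinh x * p := by
  have h := Real.cosh_sq x
  have hc := Real.cosh_pos x
  have h1 : (Real.sinh x * p) ^ 2 < Real.cosh x ^ 2 := by
    nlinarith [sq_nonneg (Real.sinh x * q)]
  linarith [lt_of_pow_lt_pow_left₀ 2 hc.le h1]

theorem exists_halfCoth_eq {ν : ℝ} (hν : 1 / 4 < ν ^ 2) (h0 : 0 < ν) :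
    ∃ ϑ, 0 < ϑ ∧ halfCoth ϑ = ν := by
  -- The relation `ν² - 1/4 = Z²` forces the partition function to be `z`, hence `sinh (ϑ/2) = 1 /
  -- (2z)`.
  set z := Real.sqrt (ν ^ 2 - 1 / 4) with hz
  have hz0 : 0 < z := Real.sqrt_pos.2 (by linarith)
  have hϑ : 0 < 2 * Real.arsinh (1 / (2 * z)) := by
    have : 0 < Real.arsinh (1 / (2 * z)) := Real.arsinh_pos_iff.2 (by positivity)
    positivity
  refine ⟨_, hϑ, ?_⟩
  have h1 : zReal (2 * Real.arsinh (1 / (2 * z))) = z := by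
    rw [zReal, mul_div_cancel_left₀ _ (by norm_num : (2 : ℝ) ≠ 0), Real.sinh_arsinh]
    field_simp
  have h2 := halfCoth_sq hϑ
  rw [h1, hz, Real.sq_sqrt (by linarith)] at h2
  exact (pow_left_inj₀ (halfCoth_pos hϑ).le h0.le two_ne_zero).1 (by linarith)

theorem halfCoth_injective {ϑ ϑ' : ℝ} (h : 0 < ϑ) (h' : 0 < ϑ') (e : halfCoth ϑ = halfCoth ϑ') :
    ϑ = ϑ' := by
  have h1 : zReal ϑ = zReal ϑ' := by rw [zReal_eq_sqrt h, zReal_eq_sqrt h', e]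
  have h2 : Real.sinh (ϑ / 2) = Real.sinh (ϑ' / 2) := by
    unfold zReal at h1
    exact inv_injective (by linarith)
  linarith [Real.sinh_injective h2]

theorem polar_sinh_unique {r p q r' p' q' : ℝ} (hr : 0 ≤ r) (hr' : 0 ≤ r')
    (h : p ^ 2 + q ^ 2 = 1) (h' : p' ^ 2 + q' ^ 2 = 1)
    (hp : Real.sinh (2 * r) * p = Real.sinh (2 * r') * p')
    (hq : Real.sinh (2 * r) * q = Real.sinh (2 * r') * q') :
    (r : ℂ) * (p + q * Complex.I) = r' * (p' + q' * Complex.I) := by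
  have hs : 0 ≤ Real.sinh (2 * r) := Real.sinh_nonneg_iff.2 (by positivity)
  have hs' : 0 ≤ Real.sinh (2 * r') := Real.sinh_nonneg_iff.2 (by positivity)
  have hsq : Real.sinh (2 * r) ^ 2 = Real.sinh (2 * r') ^ 2 := by
    linear_combination (Real.sinh (2 * r) * p + Real.sinh (2 * r') * p') * hp +
      (Real.sinh (2 * r) * q + Real.sinh (2 * r') * q') * hq - Real.sinh (2 * r) ^ 2 * h +
      Real.sinh (2 * r') ^ 2 * h'
  have he : Real.sinh (2 * r) = Real.sinh (2 * r') := (pow_left_inj₀ hs hs' two_ne_zero).1 hsq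
  have hrr : r = r' := by linarith [Real.sinh_injective he]
  subst hrr
  -- At `r = 0` the direction `(p, q)` is undetermined, but both products are zero.
  rcases hr.eq_or_lt with h0 | h0
  · rw [← h0]; simp
  · have hne : Real.sinh (2 * r) ≠ 0 := (Real.sinh_pos_iff.2 (by positivity)).ne'
    rw [mul_left_cancel₀ hne hp, mul_left_cancel₀ hne hq]

theorem exists_polar_sinh (x y : ℝ) :
    ∃ r p q : ℝ, 0 ≤ r ∧ p ^ 2 + q ^ 2 = 1 ∧ Real.sinh (2 * r) * p = x ∧
      Real.sinh (2 * r) * q = y := by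
  obtain ⟨t, p, q, ht, hpq, h⟩ := exists_polar (⟨x, y⟩ : ℂ)
  refine ⟨Real.arsinh t / 2, p, q, div_nonneg (Real.arsinh_nonneg_iff.2 ht) (by norm_num), hpq, ?_, ?_⟩
  · rw [mul_div_cancel₀ _ (two_ne_zero), Real.sinh_arsinh]
    have := congrArg Complex.re h
    simpa using this.symm
  · rw [mul_div_cancel₀ _ (two_ne_zero), Real.sinh_arsinh]
    have := congrArg Complex.im h
    simpa using this.symm

end Oscillator

/-! ### The main theorem -/

theorem mainTheorem1 (m ω : ℝ) (hm : 0 < m) (hω : 0 < ω) :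
    (∀ (ϑ : ℝ) (ζ : ℂ) (θ : ℝ), 0 < ϑ →
      -- the three exponentials exist and are uniquely determined
      (∀ E, Oscillator.IsExp (Oscillator.squeezeGen ζ) E ↔ E = Oscillator.squeeze ζ) ∧
      (∀ E, Oscillator.IsExp (Oscillator.rotationGen θ) E ↔ E = Oscillator.rotation θ) ∧
      (∀ E, Oscillator.IsExp (Oscillator.thermalGen ϑ) E ↔ E = Oscillator.boltzmann ϑ) ∧
      -- the traces that define the partition function, and the state
      Oscillator.HasTrace (Oscillator.boltzmann ϑ) (Oscillator.partitionFn ϑ) ∧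
      Oscillator.HasTrace (Oscillator.dress ζ θ (Oscillator.boltzmann ϑ))
        (Oscillator.partitionFn ϑ) ∧
      (Oscillator.squeezedThermal ϑ ζ θ).IsPositive ∧
      Oscillator.HasTrace (Oscillator.squeezedThermal ϑ ζ θ) 1 ∧
      Oscillator.HasExpectation (Oscillator.squeezedThermal ϑ ζ θ) (Oscillator.pos m ω) 0 ∧
      Oscillator.HasExpectation (Oscillator.squeezedThermal ϑ ζ θ) (Oscillator.mom m ω) 0 ∧
      -- the partition function in terms of the covariance matrix
      ∃ a b c : ℝ,
        Oscillator.HasCovariance m ω (Oscillator.squeezedThermal ϑ ζ θ) a b c ∧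
        0 < b ∧
        1 / 4 < a * b - c ^ 2 ∧
        Real.exp (2 * Oscillator.phi ϑ) = 4 * (a * b - c ^ 2) ∧
        Oscillator.partitionFn ϑ
          = ((Real.sqrt (Real.exp (2 * Oscillator.phi ϑ) - 1) / 2 : ℝ) : ℂ) ∧
        Oscillator.partitionFn ϑ = ((Real.sqrt (a * b - c ^ 2 - 1 / 4) : ℝ) : ℂ) ∧
        Oscillator.partitionFn ϑ = ((1 / 2 * (Real.sinh (ϑ / 2))⁻¹ : ℝ) : ℂ)) ∧
    -- the covariance matrix fixes `ϑ` and `ζ`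
    (∀ a b c : ℝ, 0 < b → 1 / 4 < a * b - c ^ 2 →
      ∃ (ϑ : ℝ) (ζ : ℂ), 0 < ϑ ∧
        ∀ (ϑ' : ℝ) (ζ' : ℂ) (θ' : ℝ), 0 < ϑ' →
          (Oscillator.HasCovariance m ω (Oscillator.squeezedThermal ϑ' ζ' θ') a b c ↔
            ϑ' = ϑ ∧ ζ' = ζ)) := by
  refine ⟨fun ϑ ζ θ hϑ => ?_, fun a b c hb hdet => ?_⟩
  · obtain ⟨r, p, q, -, hpq, hζ⟩ := Oscillator.exists_polar ζ
    have hν := Oscillator.halfCoth_pos hϑ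
    have hz := Oscillator.zReal_pos hϑ
    have hcov := Oscillator.hasCovariance_squeezedThermal hm hω hϑ hpq r θ
    have hu : ((p : ℂ) + q * Complex.I) * (starRingEnd ℂ) ((p : ℂ) + q * Complex.I) = 1 := by
      have h : (p : ℂ) ^ 2 + (q : ℂ) ^ 2 = 1 := by exact_mod_cast hpq
      simp only [map_add, map_mul, Complex.conj_ofReal, Complex.conj_I]
      linear_combination h - (q : ℂ) ^ 2 * Complex.I_sq
    have hpos := Oscillator.hasExpectation_lin hϑ hu r θ
    rw [← hζ] at hcov hpos
    have hdet := Oscillator.covariance_det (ν := Oscillator.halfCoth ϑ) (r := r)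
      (mul_pos hm hω) hpq
    have hsq := Oscillator.halfCoth_sq hϑ
    have hz2 : 0 < Oscillator.zReal ϑ ^ 2 := by positivity
    refine ⟨Oscillator.isExp_iff_opExp (Oscillator.quadGrowth_squeezeGen ζ)
        (Oscillator.dissipative_of_isAdj_neg (Oscillator.isAdj_squeezeGen ζ)),
      Oscillator.isExp_iff_opExp (Oscillator.quadGrowth_rotationGen θ)
        (Oscillator.dissipative_of_isAdj_neg (Oscillator.isAdj_rotationGen θ)),
      Oscillator.isExp_iff_opExp (Oscillator.quadGrowth_thermalGen ϑ)
        (Oscillator.dissipative_thermalGen hϑ), ?_, ?_,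
      Oscillator.squeezedThermal_isPositive hϑ ζ θ, Oscillator.hasTrace_squeezedThermal hϑ ζ θ,
      ?_, ?_, _, _, _, hcov, ?_, ?_, ?_, ?_, ?_, ?_⟩
    · rw [Oscillator.partitionFn_eq hϑ]
      exact Oscillator.hasTrace_boltzmann hϑ
    · rw [Oscillator.partitionFn_eq hϑ]
      exact Oscillator.hasTrace_dress_boltzmann hϑ ζ θ
    · rw [Oscillator.pos_eq_lin]
      exact hpos _ _
    · rw [Oscillator.mom_eq_lin]
      exact hpos _ _
    · exact mul_pos (div_pos hν (mul_pos hm hω)) (Oscillator.cosh_sub_sinh_mul_pos hpq)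
    · rw [hdet]; linarith
    · rw [hdet, Oscillator.exp_two_mul_phi hϑ]
    · rw [Oscillator.partitionFn_eq hϑ, Oscillator.exp_two_mul_phi hϑ,
        show 4 * Oscillator.halfCoth ϑ ^ 2 - 1 = (2 * Oscillator.zReal ϑ) ^ 2 by
          linear_combination 4 * hsq,
        Real.sqrt_sq (by positivity), mul_div_cancel_left₀ _ (two_ne_zero)]
    · rw [Oscillator.partitionFn_eq hϑ, hdet, ← Oscillator.zReal_eq_sqrt hϑ]
    · rw [Oscillator.partitionFn_eq hϑ, Oscillator.zReal]
  · have hX : 0 < m * ω := mul_pos hm hω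
    set X := m * ω with hX_def
    set ν := Real.sqrt (a * b - c ^ 2) with hν_def
    have hν0 : 0 < ν := Real.sqrt_pos.2 (by linarith)
    have hν2 : ν ^ 2 = a * b - c ^ 2 := Real.sq_sqrt (by linarith)
    have ha : 0 < a := by
      have : 0 < a * b := by nlinarith [sq_nonneg c]
      exact pos_of_mul_pos_left this hb.le
    obtain ⟨ϑ, hϑ, hϑν⟩ := Oscillator.exists_halfCoth_eq (by linarith) hν0
    -- Forced by the covariance formulas: `a / X - b X = 2 ν p sinh 2r` and `c = -ν q sinh 2r`.
    obtain ⟨r, p, q, hr, hpq, hp, hq⟩ :=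
      Oscillator.exists_polar_sinh ((a / X - b * X) / (2 * ν)) (-c / ν)
    -- The remaining combination `a / X + b X` is not free: it is positive, and its square is fixed
    -- by `a b - c² = ν²` and `cosh² = 1 + sinh²`.
    have hC : Real.cosh (2 * r) = (a / X + b * X) / (2 * ν) := by
      refine (pow_left_inj₀ (Real.cosh_pos _).le (by positivity) two_ne_zero).1 ?_
      have h1 : Real.sinh (2 * r) ^ 2 =
          ((a / X - b * X) / (2 * ν)) ^ 2 + (-c / ν) ^ 2 := by
        rw [← hp, ← hq]; linear_combination -Real.sinh (2 * r) ^ 2 * hpq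
      rw [Real.cosh_sq, h1]
      field_simp
      linear_combination 4 * X ^ 2 * hν2
    refine ⟨ϑ, r * (p + q * Complex.I), hϑ, fun ϑ' ζ' θ' hϑ' => ⟨fun h => ?_, ?_⟩⟩
    · obtain ⟨r', p', q', hr', hpq', rfl⟩ := Oscillator.exists_polar ζ'
      obtain ⟨h1, h2, h3⟩ :=
        h.unique (Oscillator.hasCovariance_squeezedThermal hm hω hϑ' hpq' r' θ')
      have hν' := Oscillator.halfCoth_pos hϑ'
      -- The determinant identifies `ν` with the value for `ϑ'`; once `ν` is known, `a`, `b` and `c`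
      -- give `sinh 2r'` times `(p', q')`.
      have hdet' := Oscillator.covariance_det (ν := Oscillator.halfCoth ϑ') (r := r') hX hpq'
      rw [← h1, ← h2, ← h3, ← hν2] at hdet'
      have hνν : ν = Oscillator.halfCoth ϑ' :=
        (pow_left_inj₀ hν0.le hν'.le two_ne_zero).1 hdet'
      rw [← hX_def, ← hνν] at h1 h2
      rw [← hνν] at h3
      refine ⟨Oscillator.halfCoth_injective hϑ' hϑ (by rw [hϑν, hνν]),
        Oscillator.polar_sinh_unique hr' hr hpq' hpq ?_ ?_⟩
      · rw [hp, h1, h2]; field_simp; ring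
      · rw [hq, h3]; field_simp
    · rintro ⟨rfl, rfl⟩
      have h := Oscillator.hasCovariance_squeezedThermal hm hω hϑ hpq r θ'
      rw [hϑν, hp, hq, hC, ← hX_def] at h
      have e1 : X * ν * ((a / X + b * X) / (2 * ν) + (a / X - b * X) / (2 * ν)) = a := by
        field_simp; ring
      have e2 : ν / X * ((a / X + b * X) / (2 * ν) - (a / X - b * X) / (2 * ν)) = b := by
        field_simp; ring
      have e3 : -(ν * (-c / ν)) = c := by field_simp
      rwa [e1, e2, e3] at h
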